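/- All graphs are simple, undirected, nonempty and connected, but not necessarily finite or locally finite; $d$ denotes the shortest-path distance, and $I(u,v)=\{x : d(u,x)+d(x,v)=d(u,v)\}$. Definitions. A graph $G$ is \emph{weakly modular} if for every vertex $u$: (triangle condition) for all $v,w$ with $1=d(v,w)<d(u,v)=d(u,w)$ there is a common neighbor $x$ of $v,w$ with $d(u,x)=d(u,v)-1$; and (quadrangle condition) for all $v,w,z$ with $d(v,z)=d(w,z)=1$ and $2=d(v,w)\le d(u,v)=d(u,w)=d(u,z)-1$ there is a common neighbor $x$ of $v,w$ with $d(u,x)=d(u,v)-1$. An \emph{swm-graph} is a weakly modular graph with no induced $K_4^-$ and no isometric $K_{3,3}^-$ ($K_4$, respectively $K_{3,3}$, minus an edge). A pair $(p,q)$ of vertices is \emph{Boolean} if the subgraph induced by $I(p,q)$ contains an isometrically embedded $k$-cube, where $k=d(p,q)$. The \emph{thickening} $G^\Delta$ is obtained from $G$ by joining by an edge all Boolean pairs $(p,q)$ with $d(p,q)\ge 2$. A set $X$ of vertices is \emph{gated} if for every vertex $x\notin X$ there is $x'\in X$ with $x'\in I(x,y)$ for all $y\in X$; it is \emph{Boolean-gated}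 if it is gated and the subgraph $H$ induced by $X$ is thick, i.e., for any two vertices $u,v$ of $H$ at distance $2$ in $H$, the interval between $u$ and $v$ in $H$ contains an induced $4$-cycle. A graph is \emph{Helly} (respectively \emph{finitely Helly}) if every family (respectively every finite family) of pairwise intersecting balls $\{x : d(v,x)\le r\}$, $r\in\mathbb{N}$, has nonempty intersection. The \emph{clique complex} $X(G)$ is the simplicial complex whose simplices are the nonempty finite cliques of $G$; its geometric realization carries the weak (CW) topology. Theorem. Let $G$ be an swm-graph. (1) $G^\Delta$ is a finitely Helly graph. (2) If all Boolean-gated sets of $G$ are finite, then $G^\Delta$ is a Helly graph and (the geometric realization of) the clique complex $X(G^\Delta)$ is contractible. (3) If $G$ is locally finite (every vertex has finitely many neighbors), then all Boolean-gated sets of $G$ are finite; in particular, the conclusions of (2) hold. -/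

import Mathlib

namespace SwmGraph

section Metric

variable {V W : Type*}

/-- The interval `I(u, v)`: all vertices on shortest `(u, v)`-paths. -/
def interval (G : SimpleGraph V) (u v : V) : Set V :=
  {x | G.dist u x + G.dist x v = G.dist u v}

/-- The closed ball of radius `r` around `v`. -/
def closedBall (G : SimpleGraph V) (v : V) (r : ℕ) : Set V :=
  {x | G.dist v x ≤ r}

/-- A distance-preserving map between (connected) graphs. -/
def IsIsometricEmbedding (G : SimpleGraph V) (H : SimpleGraph W) (φ : V → W) : Prop :=
  ∀ u v, H.dist (φ u) (φ v) = G.dist u v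

/-- A set `X` of vertices is gated if every vertex `x` outside `X` has a gate `x'` in `X`. -/
def IsGated (G : SimpleGraph V) (X : Set V) : Prop :=
  ∀ x, x ∉ X → ∃ x' ∈ X, ∀ y ∈ X, x' ∈ interval G x y

/-- The vertices `a, b, c, d` form, in this cyclic order, an induced 4-cycle. -/
def IsInducedSquare (G : SimpleGraph V) (a b c d : V) : Prop :=
  G.Adj a b ∧ G.Adj b c ∧ G.Adj c d ∧ G.Adj d a ∧
    a ≠ c ∧ ¬ G.Adj a c ∧ b ≠ d ∧ ¬ G.Adj b d

/-- A graph is thick if every interval between vertices at distance two contains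
an induced 4-cycle. -/
def IsThick (G : SimpleGraph V) : Prop :=
  ∀ u v, G.dist u v = 2 →
    ∃ a ∈ interval G u v, ∃ b ∈ interval G u v, ∃ c ∈ interval G u v, ∃ d ∈ interval G u v,
      IsInducedSquare G a b c d

end Metric

section Swm

variable {V : Type*}

/-- The triangle condition with respect to `u`. -/
def TriangleCondition (G : SimpleGraph V) (u : V) : Prop :=
  ∀ v w, G.dist v w = 1 → 1 < G.dist u v → G.dist u v = G.dist u w →
    ∃ x, G.Adj v x ∧ G.Adj w x ∧ G.dist u x + 1 = G.dist u v

/-- The quadrangle condition with respect to `u`. -/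
def QuadrangleCondition (G : SimpleGraph V) (u : V) : Prop :=
  ∀ v w z, G.dist v z = 1 → G.dist w z = 1 → G.dist v w = 2 →
    2 ≤ G.dist u v → G.dist u v = G.dist u w → G.dist u v + 1 = G.dist u z →
    ∃ x, G.Adj v x ∧ G.Adj w x ∧ G.dist u x + 1 = G.dist u v

/-- Weakly modular graphs (graphs are connected throughout). -/
def IsWeaklyModular (G : SimpleGraph V) : Prop :=
  G.Connected ∧ ∀ u, TriangleCondition G u ∧ QuadrangleCondition G u

/-- `K₄` minus an edge. -/
def K4Minus : SimpleGraph (Fin 4) :=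
  (⊤ : SimpleGraph (Fin 4)).deleteEdges {s(0, 1)}

/-- `K₃,₃` minus an edge. -/
def K33Minus : SimpleGraph (Fin 3 ⊕ Fin 3) :=
  (completeBipartiteGraph (Fin 3) (Fin 3)).deleteEdges {s(Sum.inl 0, Sum.inr 0)}

/-- Sweakly modular graphs: weakly modular graphs without induced `K₄⁻` and without
isometric `K₃,₃⁻`. -/
def IsSwmGraph (G : SimpleGraph V) : Prop :=
  IsWeaklyModular G ∧
    IsEmpty (K4Minus ↪g G) ∧
    ¬ ∃ φ : Fin 3 ⊕ Fin 3 → V, IsIsometricEmbedding K33Minus G φ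

end Swm

section Boolean

variable {V : Type*}

/-- The `k`-cube: the vertices are the subsets of a `k`-element set, two of them being adjacent
if their symmetric difference has exactly one element. -/
def cube (k : ℕ) : SimpleGraph (Finset (Fin k)) where
  Adj A B := (symmDiff A B).card = 1
  symm := ⟨fun A B h => by rwa [symmDiff_comm]⟩
  loopless := ⟨fun A h => by simp at h⟩

/-- `(p, q)` is a Boolean pair if the subgraph induced by `I(p, q)` contains an isometrically
embedded `k`-cube with `k = d(p, q)`. -/
def IsBooleanPair (G : SimpleGraph V) (p q : V) : Prop :=
  ∃ φ : Finset (Fin (G.dist p q)) → interval G p q,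
    IsIsometricEmbedding (cube (G.dist p q)) (G.induce (interval G p q)) φ

theorem interval_comm (G : SimpleGraph V) (p q : V) : interval G p q = interval G q p := by
  ext x
  simp only [interval, Set.mem_ofPred_eq]
  rw [G.dist_comm (u := p) (v := x), G.dist_comm (u := x) (v := q),
    G.dist_comm (u := p) (v := q), add_comm]

theorem IsBooleanPair.symm {G : SimpleGraph V} {p q : V} (h : IsBooleanPair G p q) :
    IsBooleanPair G q p := by
  unfold IsBooleanPair at h ⊢
  rwa [interval_comm G q p, G.dist_comm (u := q) (v := p)]

/-- A set of vertices is Boolean-gated if it induces a gated and thick subgraph. -/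
def IsBooleanGated (G : SimpleGraph V) (X : Set V) : Prop :=
  IsGated G X ∧ IsThick (G.induce X)

/-- The thickening: add to `G` an edge between the members of each Boolean pair at distance
at least two. -/
def thickening (G : SimpleGraph V) : SimpleGraph V where
  Adj p q := G.Adj p q ∨ (2 ≤ G.dist p q ∧ IsBooleanPair G p q)
  symm := ⟨fun p q h => h.imp (fun h => h.symm) fun h =>
    ⟨by rw [G.dist_comm]; exact h.1, h.2.symm⟩⟩
  loopless := ⟨fun p h => by simp at h⟩

end Boolean

section Helly

variable {V : Type*}

/-- The Helly property of a family of sets: every subfamily of pairwise intersecting sets has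
a nonempty intersection. -/
def HellyProperty (𝓕 : Set (Set V)) : Prop :=
  ∀ 𝓕' ⊆ 𝓕, (∀ F ∈ 𝓕', ∀ F' ∈ 𝓕', (F ∩ F').Nonempty) → (⋂₀ 𝓕').Nonempty

/-- The finite Helly property: the same for finite subfamilies. -/
def FiniteHellyProperty (𝓕 : Set (Set V)) : Prop :=
  ∀ 𝓕' ⊆ 𝓕, 𝓕'.Finite → (∀ F ∈ 𝓕', ∀ F' ∈ 𝓕', (F ∩ F').Nonempty) → (⋂₀ 𝓕').Nonempty

/-- The family of all balls of a graph. -/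
def balls (G : SimpleGraph V) : Set (Set V) :=
  {B | ∃ (v : V) (r : ℕ), B = closedBall G v r}

/-- Helly graphs: connected graphs whose balls have the Helly property. -/
def IsHellyGraph (G : SimpleGraph V) : Prop :=
  G.Connected ∧ HellyProperty (balls G)

/-- Finitely Helly graphs: connected graphs whose balls have the finite Helly property. -/
def IsFinitelyHellyGraph (G : SimpleGraph V) : Prop :=
  G.Connected ∧ FiniteHellyProperty (balls G)

end Helly

section Complex

variable {V : Type*}

/-- The clique complex: the simplices are the nonempty finite cliques. -/
def cliqueComplex (G : SimpleGraph V) : AbstractSimplicialComplex V where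
  faces := {s | s.Nonempty ∧ G.IsClique (s : Set V)}
  isRelLowerSet_faces := fun _ hs =>
    ⟨hs.1, fun _ hts ht => ⟨ht, hs.2.subset (Finset.coe_subset.mpr hts)⟩⟩
  singleton_mem := fun v => ⟨Finset.singleton_nonempty v, by simp⟩

/-- The underlying set of the geometric realization of an abstract simplicial complex: formal
convex combinations of vertices whose support is a simplex. -/
structure Realization (K : AbstractSimplicialComplex V) where
  /-- the barycentric coordinates -/
  coord : V →₀ ℝ
  support_mem : coord.support ∈ K.faces
  nonneg : ∀ v, 0 ≤ coord v
  sum_eq_one : ∑ v ∈ coord.support, coord v = 1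

/-- The closed simplex of the realization spanned by the vertices in `s`. -/
def closedSimplex (K : AbstractSimplicialComplex V) (s : Finset V) : Set (Realization K) :=
  {x | x.coord.support ⊆ s}

/-- The Euclidean topology of a closed simplex, given by the barycentric coordinates. -/
@[reducible] def closedSimplexTopology (K : AbstractSimplicialComplex V) (s : Finset V) :
    TopologicalSpace (closedSimplex K s) :=
  TopologicalSpace.induced (fun x (v : V) => x.1.coord v) inferInstance

/-- The weak (CW) topology of the realization: a set is open if and only if its intersection with
each closed simplex is open in that simplex. -/
instance realizationTopology (K : AbstractSimplicialComplex V) :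
    TopologicalSpace (Realization K) :=
  ⨆ s : K.faces, TopologicalSpace.coinduced
    (Subtype.val : closedSimplex K (s : Finset V) → Realization K)
    (closedSimplexTopology K (s : Finset V))

end Complex

end SwmGraph

/-! Fix `p` and write `x ≤ y` for `x ∈ I(p, y)`. Every interval `I(p, z)` of an swm-graph then
behaves like a graded modular lattice: weak modularity supplies meets and, read from `z`, joins,
while the forbidden `K₄⁻` and `K₃,₃⁻` make them unique (`not_adj_of_dist_eq`,
`eq_of_common_covers`). A pair is Boolean exactly when this lattice is atomistic (`AtomGenerated`),
a condition inherited by subintervals.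

The heart of the matter is that adding to a nonempty gated set all vertices forming a Boolean pair
with one of its members yields a gated set (`isGated_expansion`). This rests on a local criterion
for gatedness (`isGated_of_closed`) and on the closure of Boolean partners of `p` under common
neighbours (`AtomGenerated.of_common_neighbor`). Balls of the thickening arise from a point by
iterating this expansion, so they are gated, and finite families of pairwise intersecting gated sets
have a common point. This gives (1).

For infinite families, the gates of a centre `v` in growing finite intersections form an ascending
chain inside one ball of the thickening. By induction on the radius, a tail of the chain is a clique
of the thickening; it lies in a Boolean-gated set, so finiteness makes the chain stop
(`eventually_const_of_chain`). Contractibility holds for every Helly graph: each vertex other than a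
base point is dominated, within its ball, by a vertex nearer to the base point. Folding sphere after
sphere moves each vertex finitely often, so even infinitely many folds fit into unit time.

For (3), any two members `p`, `q` of a Boolean-gated set form an atomistic interval, which has at
least `d(p, q)` atoms. Hence the degree of `p` bounds the distance, and the set lies in a finite
ball. -/

namespace SwmGraph

/-! ### Intervals as graded modular lattices -/

section Lattice

variable {V : Type*} {G : SimpleGraph V} {p z a b c e m t u v w x y : V}

theorem mem_interval : x ∈ interval G u v ↔ G.dist u x + G.dist x v = G.dist u v := Iff.rfl

theorem left_mem_interval (u v : V) : u ∈ interval G u v := by simp [mem_interval]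

theorem right_mem_interval (u v : V) : v ∈ interval G u v := by simp [mem_interval]

theorem IsSwmGraph.connected (hG : IsSwmGraph G) : G.Connected := hG.1.1

theorem dist_le_add_one (hc : G.Connected) (h : G.Adj u v) (p : V) :
    G.dist p v ≤ G.dist p u + 1 := by
  have h1 := hc.dist_triangle (u := p) (v := u) (w := v)
  have h2 := SimpleGraph.dist_eq_one_iff_adj.2 h
  omega

theorem interval_trans (hc : G.Connected) (hu : u ∈ interval G p v) (hv : v ∈ interval G p z) :
    u ∈ interval G p z := by
  rw [mem_interval] at *
  have h1 := hc.dist_triangle (u := u) (v := v) (w := z)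
  have h2 := hc.dist_triangle (u := p) (v := u) (w := z)
  omega

theorem mem_interval_of_trans (hc : G.Connected) (hu : u ∈ interval G p v)
    (hv : v ∈ interval G p z) : v ∈ interval G u z := by
  rw [mem_interval] at *
  have h1 := hc.dist_triangle (u := u) (v := v) (w := z)
  have h2 := hc.dist_triangle (u := p) (v := u) (w := z)
  omega

/-- `z` covers `u` in the order `x ≤ y ↔ x ∈ I(p, y)`. -/
def Cov (G : SimpleGraph V) (p u z : V) : Prop := G.Adj u z ∧ G.dist p z = G.dist p u + 1

theorem Cov.mem_interval (h : Cov G p u z) : u ∈ interval G p z := by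
  have := SimpleGraph.dist_eq_one_iff_adj.2 h.1
  rw [SwmGraph.mem_interval, this, h.2]

theorem Cov.ne (h : Cov G p u z) : u ≠ z := h.1.ne

theorem cov_self (h : G.Adj p a) : Cov G p p a :=
  ⟨h, by simp [SimpleGraph.dist_eq_one_iff_adj.2 h]⟩

/-- Order duality: seen from `z`, the order of `I(p, z)` is reversed, so results on meets yield
results on joins. -/
theorem Cov.flip (h : Cov G p u v) (hv : v ∈ interval G p z) (hu : u ∈ interval G p z) :
    Cov G z v u := by
  refine ⟨h.1.symm, ?_⟩
  have := h.2
  rw [SwmGraph.mem_interval, G.dist_comm (v := z)] at hu hv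
  omega

theorem Cov.flip' (h : Cov G z v u) (hv : v ∈ interval G p z) (hu : u ∈ interval G p z) :
    Cov G p u v := by
  rw [interval_comm] at hu hv
  exact h.flip hu hv

/-- Every vertex `u ≠ z` in `I(p, z)` is covered by a vertex of `I(p, z)`. -/
theorem exists_cov_of_ne (hc : G.Connected) (hu : u ∈ interval G p z) (hne : u ≠ z) :
    ∃ v, Cov G p u v ∧ v ∈ interval G p z := by
  obtain ⟨q, hq⟩ := hc.exists_walk_length_eq_dist u z
  cases q with
  | nil => exact absurd rfl hne
  | @cons _ v _ h q =>
    rw [SimpleGraph.Walk.length_cons] at hq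
    have h1 := SimpleGraph.dist_le q
    have h2 := dist_le_add_one hc h p
    have h3 := hc.dist_triangle (u := p) (v := v) (w := z)
    rw [mem_interval] at hu
    refine ⟨v, ⟨h, ?_⟩, ?_⟩
    · omega
    · rw [mem_interval]; omega

theorem exists_lower_cov (hc : G.Connected) (hne : p ≠ z) : ∃ w, Cov G p w z := by
  obtain ⟨w, hw, hw'⟩ := exists_cov_of_ne hc (left_mem_interval z p) hne.symm
  exact ⟨w, hw.flip hw' (left_mem_interval z p)⟩

theorem exists_lower_cov_of_mem (hc : G.Connected) (hu : u ∈ interval G p z) (hne : u ≠ z) :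
    ∃ w, Cov G p w z ∧ u ∈ interval G p w := by
  obtain ⟨w, hw⟩ := exists_lower_cov hc hne
  have h1 := hw.2
  have h2 := dist_le_add_one hc hw.1 p
  have h3 := hc.dist_triangle (u := p) (v := u) (w := w)
  rw [mem_interval] at hu
  refine ⟨w, ⟨hw.1, ?_⟩, ?_⟩
  · omega
  · rw [mem_interval]; omega

/-- The triangle condition, extended to distance one, where `p` itself is the witness. -/
theorem exists_lower_of_adj (hG : IsSwmGraph G) (h : G.Adj u v) (e : G.dist p u = G.dist p v) :
    ∃ x, Cov G p x u ∧ Cov G p x v := by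
  rcases Nat.lt_trichotomy (G.dist p u) 1 with h0 | h0 | h0
  · have h1 : p = u := hG.connected.dist_eq_zero_iff.1 (by omega)
    have h2 : p = v := hG.connected.dist_eq_zero_iff.1 (by omega)
    exact absurd (h1.symm.trans h2) h.ne
  · exact ⟨p, cov_self (SimpleGraph.dist_eq_one_iff_adj.1 h0),
      cov_self (SimpleGraph.dist_eq_one_iff_adj.1 (e ▸ h0))⟩
  · obtain ⟨x, h1, h2, h3⟩ := (hG.1.2 p).1 u v (SimpleGraph.dist_eq_one_iff_adj.2 h) h0 e
    exact ⟨x, ⟨h1.symm, h3.symm⟩, ⟨h2.symm, by omega⟩⟩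

theorem exists_lower_of_common_upper (hG : IsSwmGraph G) (hu : Cov G p u z) (hv : Cov G p v z)
    (hne : u ≠ v) (hna : ¬ G.Adj u v) : ∃ x, Cov G p x u ∧ Cov G p x v := by
  have hu2 := hu.2
  have hv2 := hv.2
  have hd : G.dist u v = 2 := by
    have h1 := hG.connected.one_lt_dist_of_ne_of_not_adj hne hna
    have h2 := hG.connected.dist_triangle (u := u) (v := z) (w := v)
    rw [SimpleGraph.dist_eq_one_iff_adj.2 hu.1, SimpleGraph.dist_eq_one_iff_adj.2 hv.1.symm] at h2
    omega
  rcases Nat.lt_trichotomy (G.dist p u) 1 with h0 | h0 | h0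
  · have h1 : p = u := hG.connected.dist_eq_zero_iff.1 (by omega)
    have h2 : p = v := hG.connected.dist_eq_zero_iff.1 (by omega)
    exact absurd (h1.symm.trans h2) hne
  · exact ⟨p, cov_self (SimpleGraph.dist_eq_one_iff_adj.1 h0),
      cov_self (SimpleGraph.dist_eq_one_iff_adj.1 (by omega))⟩
  · obtain ⟨x, h1, h2, h3⟩ := (hG.1.2 p).2 u v z (SimpleGraph.dist_eq_one_iff_adj.2 hu.1)
      (SimpleGraph.dist_eq_one_iff_adj.2 hv.1) hd h0 (by omega) (by omega)
    exact ⟨x, ⟨h1.symm, h3.symm⟩, ⟨h2.symm, by omega⟩⟩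

theorem adj_of_common_edge (hG : IsSwmGraph G) (hab : G.Adj a b) (hxa : G.Adj x a)
    (hxb : G.Adj x b) (hya : G.Adj y a) (hyb : G.Adj y b) (hne : x ≠ y) : G.Adj x y := by
  by_contra hna
  refine hG.2.1.false ⟨⟨![x, y, a, b], ?_⟩, ?_⟩
  · intro i j
    fin_cases i <;> fin_cases j <;>
      simp [hne, hne.symm, hxa.ne, hxb.ne, hya.ne, hyb.ne, hab.ne, hxa.ne.symm, hxb.ne.symm,
        hya.ne.symm, hyb.ne.symm, hab.ne.symm]
  · intro i j
    have hna' : ¬ G.Adj y x := fun h => hna h.symm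
    change G.Adj (![x, y, a, b] i) (![x, y, a, b] j) ↔ K4Minus.Adj i j
    fin_cases i <;> fin_cases j <;>
      simp [K4Minus, hna, hna', hab, hxa, hxb, hya, hyb, hab.symm, hxa.symm, hxb.symm, hya.symm,
        hyb.symm]

theorem dist_le_of_hom {W : Type*} {H : SimpleGraph W} (hH : H.Connected) {φ : W → V}
    (hφ : ∀ i j, H.Adj i j → G.Adj (φ i) (φ j)) (i j : W) :
    G.dist (φ i) (φ j) ≤ H.dist i j := by
  obtain ⟨q, hq⟩ := hH.exists_walk_length_eq_dist i j
  have := SimpleGraph.dist_le (q.map (⟨φ, fun h => hφ _ _ h⟩ : H →g G))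
  rw [SimpleGraph.Walk.length_map, hq] at this
  exact this

theorem K33Minus_adj (i j : Fin 3) (h : ¬ (i = 0 ∧ j = 0)) :
    K33Minus.Adj (Sum.inl i) (Sum.inr j) := by
  simp [K33Minus, completeBipartiteGraph]
  tauto

/-- Distinct non-adjacent vertices of one class are at distance at least two, so no distance of
`K₃,₃⁻` shrinks and the copy is isometric. -/
theorem not_K33Minus (hG : IsSwmGraph G) {f g : Fin 3 → V}
    (hadj : ∀ i j, ¬ (i = 0 ∧ j = 0) → G.Adj (f i) (g j)) (hd : G.dist (f 0) (g 0) = 3)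
    (hf : ∀ i j, i ≠ j → f i ≠ f j ∧ ¬ G.Adj (f i) (f j))
    (hg : ∀ i j, i ≠ j → g i ≠ g j ∧ ¬ G.Adj (g i) (g j)) : False := by
  refine hG.2.2 ⟨Sum.elim f g, ?_⟩
  have r01 := K33Minus_adj 0 1 (by simp)
  have r11 := K33Minus_adj 1 1 (by simp)
  have r10 := K33Minus_adj 1 0 (by simp)
  have hl : ∀ i, K33Minus.Reachable (Sum.inl i) (Sum.inr 1) := fun i =>
    (K33Minus_adj i 1 (by simp)).reachable
  have hr : ∀ i, K33Minus.Reachable (Sum.inr i) (Sum.inr 1) := fun i =>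
    (K33Minus_adj 1 i (by simp)).symm.reachable.trans r11.reachable
  have hK : K33Minus.Connected := by
    have : ∀ u, K33Minus.Reachable u (Sum.inr 1) := by
      rintro (i | i)
      exacts [hl i, hr i]
    exact ⟨fun u v => (this u).trans (this v).symm⟩
  have hhom : ∀ i j, K33Minus.Adj i j → G.Adj (Sum.elim f g i) (Sum.elim f g j) := by
    rintro (i | i) (j | j) h
    · simp [K33Minus, completeBipartiteGraph] at h
    · exact hadj i j (by rintro ⟨rfl, rfl⟩; simp [K33Minus] at h)
    · exact (hadj j i (by rintro ⟨rfl, rfl⟩; simp [K33Minus] at h)).symm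
    · simp [K33Minus, completeBipartiteGraph] at h
  have hc := hG.connected
  have hlr : ∀ i j, K33Minus.dist (Sum.inl i) (Sum.inr j) ≤ G.dist (f i) (g j) := by
    intro i j
    by_cases h : i = 0 ∧ j = 0
    · obtain ⟨rfl, rfl⟩ := h
      rw [hd]
      exact SimpleGraph.dist_le (.cons r01 (.cons r11.symm (.cons r10 .nil)))
    · rw [SimpleGraph.dist_eq_one_iff_adj.2 (hadj i j h),
        SimpleGraph.dist_eq_one_iff_adj.2 (K33Minus_adj i j h)]
  intro u v
  refine le_antisymm (dist_le_of_hom hK hhom u v) ?_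
  rcases u with i | i <;> rcases v with j | j
  · by_cases h : i = j
    · simp [h]
    · have := hc.one_lt_dist_of_ne_of_not_adj (hf i j h).1 (hf i j h).2
      refine le_trans ?_ this
      exact SimpleGraph.dist_le (.cons (K33Minus_adj i 1 (by simp))
        (.cons (K33Minus_adj j 1 (by simp)).symm .nil))
  · exact hlr i j
  · rw [SimpleGraph.dist_comm, G.dist_comm]
    exact hlr j i
  · by_cases h : i = j
    · simp [h]
    · have := hc.one_lt_dist_of_ne_of_not_adj (hg i j h).1 (hg i j h).2
      refine le_trans ?_ this
      exact SimpleGraph.dist_le (.cons (K33Minus_adj 1 i (by simp)).symm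
        (.cons (K33Minus_adj 1 j (by simp)) .nil))

/-- A horizontal edge would have a common neighbour one level down and another one level up. The
absence of `K₄⁻` makes these two adjacent, although their levels differ by two. -/
theorem not_adj_of_dist_eq (hG : IsSwmGraph G) (hu : u ∈ interval G p z)
    (hv : v ∈ interval G p z) (e : G.dist p u = G.dist p v) : ¬ G.Adj u v := by
  intro h
  rw [mem_interval] at hu hv
  obtain ⟨x, h1, h2⟩ := exists_lower_of_adj hG h e
  obtain ⟨y, h3, h4⟩ := exists_lower_of_adj (p := z) hG h
    (by rw [G.dist_comm (u := z), G.dist_comm (u := z)]; omega)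
  have h5 := hG.connected.dist_triangle (u := p) (v := y) (w := z)
  have h6 := h1.2
  have h7 := h3.2
  rw [G.dist_comm (u := z), G.dist_comm (u := z)] at h7
  have hne : x ≠ y := by rintro rfl; omega
  have h8 := dist_le_add_one hG.connected
    (adj_of_common_edge hG h h1.1 h2.1 h3.1 h4.1 hne) p
  omega

/-- If `b ≠ e`, a common lower neighbour `x` of `a`, `c` and a common upper neighbour `y` of `b`,
`e` complete the square to a `K₃,₃⁻` whose missing edge is `xy`. -/
theorem eq_of_common_covers (hG : IsSwmGraph G) (hac : a ≠ c) (hab : Cov G p a b)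
    (hcb : Cov G p c b) (hae : Cov G p a e) (hce : Cov G p c e) (hb : b ∈ interval G p z)
    (he : e ∈ interval G p z) : b = e := by
  by_contra hbe
  have hc := hG.connected
  have e1 := hab.2
  have e2 := hcb.2
  have e3 := hae.2
  have hnac := not_adj_of_dist_eq hG hab.mem_interval hcb.mem_interval (by omega)
  have hnbe := not_adj_of_dist_eq hG hb he (by omega)
  obtain ⟨x, hxa, hxc⟩ := exists_lower_of_common_upper hG hab hcb hac hnac
  have ha := interval_trans hc hab.mem_interval hb
  obtain ⟨y, hyb, hye⟩ := exists_lower_of_common_upper hG (hab.flip hb ha) (hae.flip he ha) hbe hnbe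
  have hx := interval_trans hc hxa.mem_interval ha
  have hyI : Cov G p b y ∧ y ∈ interval G p z := by
    have h1 := hyb.2
    have h2 := dist_le_add_one hc hyb.1.symm p
    have h3 := hc.dist_triangle (u := p) (v := y) (w := z)
    rw [mem_interval] at hb
    rw [G.dist_comm (u := z), G.dist_comm (u := z)] at h1
    refine ⟨⟨hyb.1.symm, ?_⟩, ?_⟩
    · omega
    · rw [mem_interval]; omega
  have hxy : G.dist x y = 3 := by
    have h1 := mem_interval_of_trans hc hab.mem_interval hyI.1.mem_interval
    have h2 := mem_interval_of_trans hc hxa.mem_interval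
      (interval_trans hc hab.mem_interval hyI.1.mem_interval)
    rw [mem_interval, SimpleGraph.dist_eq_one_iff_adj.2 hxa.1] at h2
    rw [mem_interval, SimpleGraph.dist_eq_one_iff_adj.2 hab.1,
      SimpleGraph.dist_eq_one_iff_adj.2 hyI.1.1] at h1
    omega
  have hxl : ∀ v, G.Adj x v → G.dist p v ≤ G.dist p x + 1 := fun v h => dist_le_add_one hc h p
  have g1 := hxa.2
  have g2 := hyI.1.2
  have hxb : x ≠ b ∧ ¬ G.Adj x b := by
    refine ⟨by rintro rfl; omega, fun h => ?_⟩
    have := hxl b h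
    omega
  have hxe : x ≠ e ∧ ¬ G.Adj x e := by
    refine ⟨by rintro rfl; omega, fun h => ?_⟩
    have := hxl e h
    omega
  have hyl : ∀ v, G.Adj v y → G.dist p y ≤ G.dist p v + 1 := fun v h => dist_le_add_one hc h p
  have hya : y ≠ a ∧ ¬ G.Adj y a := by
    refine ⟨by rintro rfl; omega, fun h => ?_⟩
    have := hyl a h.symm
    omega
  have hyc : y ≠ c ∧ ¬ G.Adj y c := by
    refine ⟨by rintro rfl; omega, fun h => ?_⟩
    have := hyl c h.symm
    omega
  refine not_K33Minus hG (f := ![x, b, e]) (g := ![y, a, c]) ?_ hxy ?_ ?_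
  · intro i j
    fin_cases i <;> fin_cases j <;>
      simp [hxa.1, hxc.1, hyb.1.symm, hye.1.symm, hab.1.symm, hcb.1.symm, hae.1.symm, hce.1.symm]
  · intro i j
    fin_cases i <;> fin_cases j <;>
      simp [hxb, hxe, hbe, hnbe, hxb.1.symm, hxe.1.symm, Ne.symm hbe, G.adj_comm b x,
        G.adj_comm e x, G.adj_comm e b]
  · intro i j
    fin_cases i <;> fin_cases j <;>
      simp [hya, hyc, hac, hnac, hya.1.symm, hyc.1.symm, Ne.symm hac, G.adj_comm a y,
        G.adj_comm c y, G.adj_comm c a]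

/-- Two vertices covered by a common vertex have a meet, which they cover. -/
theorem exists_meet (hG : IsSwmGraph G) (hu : Cov G p u z) (hv : Cov G p v z) (hne : u ≠ v) :
    ∃ m, Cov G p m u ∧ Cov G p m v ∧
      ∀ t, t ∈ interval G p u → t ∈ interval G p v → t ∈ interval G p m := by
  have hc := hG.connected
  have e1 := hu.2
  have e2 := hv.2
  have hna := not_adj_of_dist_eq hG hu.mem_interval hv.mem_interval (by omega)
  obtain ⟨m, hmu, hmv⟩ := exists_lower_of_common_upper hG hu hv hne hna
  refine ⟨m, hmu, hmv, fun t htu htv => ?_⟩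
  have a1 := mem_interval_of_trans hc htu hu.mem_interval
  have a2 := mem_interval_of_trans hc htv hv.mem_interval
  have huz := SimpleGraph.dist_eq_one_iff_adj.2 hu.1
  have hvz := SimpleGraph.dist_eq_one_iff_adj.2 hv.1
  rw [mem_interval] at a1 a2 htu htv
  -- Applying the quadrangle condition from `t` yields a common lower neighbour above `t`; by
  -- uniqueness it is `m`.
  obtain ⟨m', h1, h2⟩ := exists_lower_of_common_upper (p := t) hG ⟨hu.1, by omega⟩
    ⟨hv.1, by omega⟩ hne hna
  have key : ∀ s, Cov G t m' s → G.dist p t + G.dist t s = G.dist p s →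
      G.dist p s = G.dist p u → Cov G p m' s ∧ t ∈ interval G p m' := by
    intro s hs hts hl
    have b1 := hs.2
    have b2 := dist_le_add_one hc hs.1 p
    have b3 := hc.dist_triangle (u := p) (v := t) (w := m')
    refine ⟨⟨hs.1, by omega⟩, ?_⟩
    rw [mem_interval]; omega
  obtain ⟨k1, k2⟩ := key u h1 htu rfl
  obtain ⟨k3, -⟩ := key v h2 htv (by omega)
  have : m' = m := by
    by_contra hmm
    exact hne (eq_of_common_covers hG hmm k1 hmu k3 hmv hu.mem_interval hv.mem_interval)
  rwa [← this]

/-- Two vertices of `I(p, z)` covering a common vertex have a join, which covers them. -/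
theorem exists_join (hG : IsSwmGraph G) (hu : Cov G p m u) (hv : Cov G p m v) (hne : u ≠ v)
    (huz : u ∈ interval G p z) (hvz : v ∈ interval G p z) :
    ∃ j, Cov G p u j ∧ Cov G p v j ∧ j ∈ interval G p z := by
  have hc := hG.connected
  have hm := interval_trans hc hu.mem_interval huz
  -- A meet in the order based at `z` is a join in the order based at `p`.
  obtain ⟨j, h1, h2, -⟩ := exists_meet hG (hu.flip huz hm) (hv.flip hvz hm) hne
  have hj : j ∈ interval G p z := by
    rw [interval_comm]
    rw [interval_comm] at huz
    exact interval_trans hc h1.mem_interval huz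
  exact ⟨j, h1.flip' hj huz, h2.flip' hj hvz, hj⟩

/-- By uniqueness, `w` is the meet of its two distinct covers. -/
theorem Cov.unique_below (hG : IsSwmGraph G) (hwx : Cov G p w x) (hwy : Cov G p w y)
    (hx : x ∈ interval G p z) (hy : y ∈ interval G p z) (hne : x ≠ y)
    (hax : a ∈ interval G p x) (hay : a ∈ interval G p y) : a ∈ interval G p w := by
  obtain ⟨j, h1, h2, hj⟩ := exists_join hG hwx hwy hne hx hy
  obtain ⟨m, h3, h4, h5⟩ := exists_meet hG h1 h2 hne
  have : w = m := by
    by_contra hmm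
    exact hne (eq_of_common_covers hG hmm hwx h3 hwy h4 hx hy)
  rw [this]
  exact h5 a hax hay

/-- Joining a vertex `u` with a cover `x` of a vertex `w` below `u`. -/
theorem exists_cov_join (hG : IsSwmGraph G) (hw : w ∈ interval G p u) (hwx : Cov G p w x)
    (hu : u ∈ interval G p z) (hx : x ∈ interval G p z) (hxu : x ∉ interval G p u) :
    ∃ y, Cov G p u y ∧ y ∈ interval G p z ∧ x ∈ interval G p y := by
  have hc := hG.connected
  induction n : G.dist w u generalizing w x with
  | zero =>
    obtain rfl := hc.dist_eq_zero_iff.1 n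
    exact ⟨x, hwx, hx, right_mem_interval _ _⟩
  | succ n ih =>
    have hne : w ≠ u := by rintro rfl; simp at n
    -- Climb from `w` to `u`, replacing `x` at each step by its join with the next vertex `w'`.
    obtain ⟨w', h1, h2⟩ := exists_cov_of_ne hc hw hne
    have hxw : x ≠ w' := by rintro rfl; exact hxu h2
    obtain ⟨j, h3, h4, h5⟩ := exists_join hG hwx h1 hxw hx (interval_trans hc h2 hu)
    obtain ⟨y, k1, k2, k3⟩ := ih h2 h4 h5
      (fun hj => hxu (interval_trans hc h3.mem_interval hj)) (by
        have := h1.2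
        rw [mem_interval] at hw h2
        omega)
    exact ⟨y, k1, k2, interval_trans hc h3.mem_interval k3⟩

/-- If `w` is a coatom of `I(p, z)` and `u` is not below `w`, then the meet of `u` and `w` is
covered by `u`. -/
theorem exists_cov_meet (hG : IsSwmGraph G) (hu : u ∈ interval G p z) (hw : Cov G p w z)
    (huw : u ∉ interval G p w) : ∃ c, Cov G p c u ∧ c ∈ interval G p w := by
  have hc := hG.connected
  have hwz := hw.mem_interval
  have hzz : z ∈ interval G z p := left_mem_interval z p
  have hu' : u ∈ interval G z p := by rwa [interval_comm]
  have hw' : w ∈ interval G z p := by rwa [interval_comm]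
  have hwu : w ∉ interval G z u := fun h => huw (by
    have := mem_interval_of_trans hc h hu'
    rwa [interval_comm] at this)
  -- Dually, `w` is an atom seen from `z`, and its join with `u` there is the wanted meet.
  obtain ⟨c, h1, h2, h3⟩ := exists_cov_join hG (left_mem_interval z u)
    (hw.flip (right_mem_interval p z) hwz) hu' hw' hwu
  have h4 := mem_interval_of_trans hc h3 h2
  rw [interval_comm] at h2 h4
  exact ⟨c, h1.flip' hu h2, h4⟩

/-- The only other possibility is `d(t, u) = d(p, u)`. The triangle condition from `u` would then
give an atom adjacent to `t` within `I(p, z)`. -/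
theorem dist_atom (hG : IsSwmGraph G) (ht : G.Adj p t) (htz : t ∈ interval G p z)
    (hu : u ∈ interval G p z) (htu : t ∉ interval G p u) : G.dist t u = G.dist p u + 1 := by
  have hc := hG.connected
  have h1 := SimpleGraph.dist_eq_one_iff_adj.2 ht
  have h2 := hc.dist_triangle (u := t) (v := p) (w := u)
  have h3 := hc.dist_triangle (u := p) (v := t) (w := u)
  rw [G.dist_comm (u := t) (v := p)] at h2
  rw [mem_interval] at htu
  by_contra hne
  obtain ⟨x, h4, h5⟩ := exists_lower_of_adj (p := u) hG ht
    (by rw [G.dist_comm, G.dist_comm (u := u)]; omega)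
  have h6 := h4.2
  rw [G.dist_comm, G.dist_comm (u := u) (v := x)] at h6
  have h7 := SimpleGraph.dist_eq_one_iff_adj.2 h4.1.symm
  have h8 : x ∈ interval G p z := interval_trans hc (by rw [mem_interval]; omega) hu
  exact not_adj_of_dist_eq hG h8 htz (h7.trans h1.symm) h5.1

end Lattice

/-! ### Atomistic intervals -/

section AtomGenerated

variable {V : Type*} {G : SimpleGraph V} {p z a b c e m t u v w x y : V}

/-- Every vertex of `I(p, x)` is the join of the neighbours of `p` below it, in the order
`u ≤ v ↔ u ∈ I(p, v)`. -/
def AtomGenerated (G : SimpleGraph V) (p x : V) : Prop :=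
  ∀ z ∈ interval G p x, ∀ w, Cov G p w z →
    ∃ a, G.Adj p a ∧ a ∈ interval G p z ∧ a ∉ interval G p w

theorem eq_of_mem_interval_self (hc : G.Connected) (h : x ∈ interval G p p) : x = p := by
  rw [mem_interval, SimpleGraph.dist_self] at h
  exact (hc.dist_eq_zero_iff.1 (by omega)).symm

theorem AtomGenerated.refl (hc : G.Connected) (p : V) : AtomGenerated G p p := by
  intro z hz w hw
  obtain rfl := eq_of_mem_interval_self hc hz
  have := hw.2
  simp at this

theorem AtomGenerated.mono (hc : G.Connected) (h : AtomGenerated G p x)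
    (hz : z ∈ interval G p x) : AtomGenerated G p z :=
  fun _ hu => h _ (interval_trans hc hu hz)

/-- One atom outside a single atomistic coatom suffices: modularity transports it to every other
coatom `w'`. Induction on the rank, applied to the meet of `w` and `w'`, makes `w'` atomistic as
well. -/
theorem AtomGenerated.of_cov (hG : IsSwmGraph G) (hw : AtomGenerated G p w) (hwz : Cov G p w z)
    (ha : G.Adj p a) (haz : a ∈ interval G p z) (haw : a ∉ interval G p w) :
    AtomGenerated G p z := by
  have hc := hG.connected
  induction hn : G.dist p w using Nat.strong_induction_on generalizing w z a with
  | _ n ih =>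
  have key : ∀ w', Cov G p w' z → w' ≠ w → AtomGenerated G p w' ∧
      ∃ b, G.Adj p b ∧ b ∈ interval G p z ∧ b ∉ interval G p w' := by
    intro w' hw' hne
    obtain ⟨m, hm, hm', hmax⟩ := exists_meet hG hwz hw' hne.symm
    obtain ⟨b, hb, hbw, hbm⟩ := hw w (right_mem_interval _ _) m hm
    have hbw' : b ∉ interval G p w' := fun h => hbm (hmax b hbw h)
    have hbz := interval_trans hc hbw hwz.mem_interval
    refine ⟨?_, b, hb, hbz, hbw'⟩
    have hlt : G.dist p m < n := by
      have := hm.2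
      omega
    have hmw := hw.mono hc hm.mem_interval
    by_cases haw' : a ∈ interval G p w'
    · exact ih _ hlt hmw hm' ha haw' (fun h => haw (interval_trans hc h hm.mem_interval)) rfl
    · have hab : a ≠ b := by rintro rfl; exact haw hbw
      -- The rank-two join `j` of `a` and `b` meets `w'` in an atom `e`. If `e` were below `m`, then
      -- `j`, being the join of `b` and `e`, would be below `w`, and so would `a`.
      obtain ⟨j, hj1, hj2, hjz⟩ := exists_join hG (cov_self ha) (cov_self hb) hab haz hbz
      obtain ⟨e, he, hew⟩ := exists_cov_meet hG hjz hw' fun h =>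
        hbw' (interval_trans hc hj2.mem_interval h)
      have hpe : G.Adj p e := by
        have h1 := he.2
        rw [hj1.2, SimpleGraph.dist_eq_one_iff_adj.2 ha] at h1
        exact SimpleGraph.dist_eq_one_iff_adj.1 (by omega)
      refine ih _ hlt hmw hm' hpe hew (fun hem => haw ?_) rfl
      have hew2 := interval_trans hc hem hm.mem_interval
      have hbe : b ≠ e := by rintro rfl; exact hbw' hew
      obtain ⟨j', h1, h2, h3⟩ := exists_join hG (cov_self hb) (cov_self hpe) hbe hbw hew2
      have : j = j' := eq_of_common_covers hG hbe hj2 he h1 h2 hjz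
        (interval_trans hc h3 hwz.mem_interval)
      rw [← this] at h3
      exact interval_trans hc hj1.mem_interval h3
  intro u hu c hcu
  by_cases huz : u = z
  · subst huz
    by_cases hcw : c = w
    · exact ⟨a, ha, haz, hcw ▸ haw⟩
    · exact (key c hcu hcw).2
  · obtain ⟨w', hw', huw'⟩ := exists_lower_cov_of_mem hc hu huz
    by_cases hww : w' = w
    · exact hw u (hww ▸ huw') c hcu
    · exact (key w' hw' hww).1 u huw' c hcu

theorem AtomGenerated.of_adj (hG : IsSwmGraph G) (h : G.Adj p x) : AtomGenerated G p x :=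
  (AtomGenerated.refl hG.connected p).of_cov hG (cov_self h) h (right_mem_interval _ _)
    (fun hx => h.ne (eq_of_mem_interval_self hG.connected hx).symm)

end AtomGenerated

/-! ### Boolean pairs are the atomistic intervals -/

section Cube

variable {ι : Type*} [DecidableEq ι]

theorem insert_eq_symmDiff {A : Finset ι} {i : ι} (h : i ∉ A) : insert i A = symmDiff A {i} := by
  ext x
  simp only [Finset.mem_insert, Finset.mem_symmDiff, Finset.mem_singleton]
  grind

theorem card_symmDiff_add (A B : Finset ι) :
    (symmDiff A B).card + A.card + B.card = 2 * (A ∪ B).card := by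
  have h1 := Finset.card_union_add_card_inter A B
  have h2 : symmDiff A B = (A ∪ B) \ (A ∩ B) := symmDiff_eq_sup_sdiff_inf A B
  have h3 : A ∩ B ⊆ A ∪ B := Finset.inter_subset_left.trans Finset.subset_union_left
  have h4 := Finset.card_le_card h3
  rw [h2, Finset.card_sdiff_of_subset h3]
  omega

theorem card_symmDiff_le_length {k : ℕ} {A B : Finset (Fin k)} (q : (cube k).Walk A B) :
    (symmDiff A B).card ≤ q.length := by
  induction q with
  | nil => simp
  | @cons A B C h q ih =>
    have h1 : symmDiff A C ⊆ symmDiff A B ∪ symmDiff B C := symmDiff_triangle A B C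
    have h2 := (Finset.card_le_card h1).trans (Finset.card_union_le _ _)
    have h3 : (symmDiff A B).card = 1 := h
    rw [SimpleGraph.Walk.length_cons]
    omega

theorem exists_cube_walk {k : ℕ} (A B : Finset (Fin k)) :
    ∃ q : (cube k).Walk A B, q.length = (symmDiff A B).card := by
  induction n : (symmDiff A B).card generalizing A with
  | zero =>
    obtain rfl : A = B := by simpa using n
    exact ⟨.nil, rfl⟩
  | succ n ih =>
    obtain ⟨i, hi⟩ : (symmDiff A B).Nonempty := by rw [← Finset.card_pos]; omega
    have h1 : symmDiff (symmDiff A {i}) B = (symmDiff A B).erase i := by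
      rw [symmDiff_right_comm]
      ext x
      simp only [Finset.mem_symmDiff, Finset.mem_singleton, Finset.mem_erase] at hi ⊢
      grind
    obtain ⟨q, hq⟩ := ih (symmDiff A {i}) (by rw [h1, Finset.card_erase_of_mem hi, n]; rfl)
    have hadj : (cube k).Adj A (symmDiff A {i}) := by
      change (symmDiff A (symmDiff A {i})).card = 1
      simp
    exact ⟨.cons hadj q, by simp [hq]⟩

theorem cube_connected (k : ℕ) : (cube k).Connected :=
  ⟨fun A B => (exists_cube_walk A B).choose.reachable⟩

theorem cube_dist {k : ℕ} (A B : Finset (Fin k)) :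
    (cube k).dist A B = (symmDiff A B).card := by
  obtain ⟨q, hq⟩ := exists_cube_walk A B
  obtain ⟨q', hq'⟩ := (cube_connected k).exists_walk_length_eq_dist A B
  exact le_antisymm (hq ▸ SimpleGraph.dist_le q) (hq' ▸ card_symmDiff_le_length q')

variable {V : Type*} {G : SimpleGraph V} {p z a b c e m t u v w x y : V}

/-- A map of the cube of subsets of `T` to the interval `I(p, z)` that is graded and locally
injective. -/
structure IsLevelCube (G : SimpleGraph V) (p z : V) (T : Finset ι) (ψ : Finset ι → V) :
    Prop where
  empty : ψ ∅ = p
  top : ψ T = z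
  cov : ∀ A ⊆ T, ∀ i ∈ T, i ∉ A → Cov G p (ψ A) (ψ (insert i A))
  ne : ∀ A ⊆ T, ∀ i ∈ T, ∀ j ∈ T, i ≠ j → i ∉ A → j ∉ A → ψ (insert i A) ≠ ψ (insert j A)

namespace IsLevelCube

variable {T : Finset ι} {ψ : Finset ι → V}

theorem mono (hc : G.Connected) (h : IsLevelCube G p z T ψ) {A B : Finset ι} (hA : A ⊆ T)
    (hB : B ⊆ T) : ψ A ∈ interval G p (ψ (A ∪ B)) := by
  induction B using Finset.induction_on with
  | empty => simp [right_mem_interval]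
  | insert i B hi ih =>
    rw [Finset.insert_subset_iff] at hB
    rw [Finset.union_insert]
    by_cases hiA : i ∈ A ∪ B
    · rw [Finset.insert_eq_of_mem hiA]
      exact ih hB.2
    · exact interval_trans hc (ih hB.2)
        (h.cov _ (Finset.union_subset hA hB.2) i hB.1 hiA).mem_interval

theorem mono' (hc : G.Connected) (h : IsLevelCube G p z T ψ) {A B : Finset ι} (hAB : A ⊆ B)
    (hB : B ⊆ T) : ψ A ∈ interval G p (ψ B) := by
  have := h.mono hc (hAB.trans hB) hB
  rwa [Finset.union_eq_right.2 hAB] at this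

theorem mem (hc : G.Connected) (h : IsLevelCube G p z T ψ) {A : Finset ι} (hA : A ⊆ T) :
    ψ A ∈ interval G p z := by
  have := h.mono' hc hA subset_rfl
  rwa [h.top] at this

theorem level (h : IsLevelCube G p z T ψ) {A : Finset ι} (hA : A ⊆ T) :
    G.dist p (ψ A) = A.card := by
  induction A using Finset.induction_on with
  | empty => simp [h.empty]
  | insert i A hi ih =>
    rw [Finset.insert_subset_iff] at hA
    rw [(h.cov A hA.2 i hA.1 hi).2, ih hA.2, Finset.card_insert_of_notMem hi]

theorem adj (h : IsLevelCube G p z T ψ) {i : ι} (hi : i ∈ T) : G.Adj p (ψ {i}) := by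
  have := (h.cov ∅ (Finset.empty_subset _) i hi (Finset.notMem_empty i)).1
  rwa [h.empty] at this

/-- Since `ψ A` is the meet of `ψ (insert i A)` and `ψ (insert j A)`, an atom below both is already
below `ψ A`; this drives the induction. -/
theorem atom_notMem (hG : IsSwmGraph G) (h : IsLevelCube G p z T ψ) {A : Finset ι} (hA : A ⊆ T)
    {i : ι} (hi : i ∈ T) (hiA : i ∉ A) : ψ {i} ∉ interval G p (ψ A) := by
  have hc := hG.connected
  induction A using Finset.induction_on with
  | empty =>
    rw [h.empty]
    exact fun hx => (h.adj hi).ne (eq_of_mem_interval_self hc hx).symm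
  | insert j A hj ih =>
    rw [Finset.insert_subset_iff] at hA
    rw [Finset.mem_insert, not_or] at hiA
    intro hmem
    refine ih hA.2 hiA.2 ?_
    refine Cov.unique_below hG (h.cov A hA.2 i hi hiA.2) (h.cov A hA.2 j hA.1 hj)
      (h.mem hc (Finset.insert_subset hi hA.2)) (h.mem hc (Finset.insert_subset hA.1 hA.2))
      (h.ne A hA.2 i hi j hA.1 hiA.1 hiA.2 hj) ?_ hmem
    exact h.mono' hc (by simp) (Finset.insert_subset hi hA.2)

theorem atomGenerated (hG : IsSwmGraph G) (h : IsLevelCube G p z T ψ) : AtomGenerated G p z := by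
  have hc := hG.connected
  have : ∀ A ⊆ T, AtomGenerated G p (ψ A) := by
    intro A
    induction A using Finset.induction_on with
    | empty => exact fun _ => h.empty ▸ AtomGenerated.refl hc p
    | insert i A hi ih =>
      intro hA
      rw [Finset.insert_subset_iff] at hA
      exact (ih hA.2).of_cov hG (h.cov A hA.2 i hA.1 hi) (h.adj hA.1)
        (h.mono' hc (by simp) (Finset.insert_subset hA.1 hA.2)) (h.atom_notMem hG hA.2 hA.1 hi)
  have := this T subset_rfl
  rwa [h.top] at this

/-- The fourth corner of each square of the cube is the join of its two middle corners, hence lies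
below any common upper bound in the interval. -/
theorem insert_mem (hG : IsSwmGraph G) (h : IsLevelCube G p z T ψ) (hu : u ∈ interval G p z)
    {A : Finset ι} (hA : A ⊆ T) {i : ι} (hi : i ∈ T) (hAu : ψ A ∈ interval G p u)
    (hiu : ψ {i} ∈ interval G p u) : ψ (insert i A) ∈ interval G p u := by
  have hc := hG.connected
  induction A using Finset.induction_on with
  | empty => exact hiu
  | insert j A hj ih =>
    by_cases hij : i ∈ insert j A
    · rwa [Finset.insert_eq_of_mem hij]
    rw [Finset.insert_subset_iff] at hA
    rw [Finset.mem_insert, not_or] at hij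
    have c1 := h.cov A hA.2 j hA.1 hj
    have c2 := h.cov A hA.2 i hi hij.2
    have hiAu := ih hA.2 (interval_trans hc c1.mem_interval hAu)
    have hne := h.ne A hA.2 i hi j hA.1 hij.1 hij.2 hj
    obtain ⟨y, h1, h2, h3⟩ := exists_join hG c2 c1 hne hiAu hAu
    have c3 := h.cov (insert j A) (Finset.insert_subset hA.1 hA.2) i hi (by simp [hij])
    have c4 := h.cov (insert i A) (Finset.insert_subset hi hA.2) j hA.1
      (by simp [hj, Ne.symm hij.1])
    rw [Finset.insert_comm] at c4
    have : y = ψ (insert i (insert j A)) := eq_of_common_covers hG hne h1 h2 c4 c3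
      (interval_trans hc h3 hu)
      (h.mem hc (Finset.insert_subset hi (Finset.insert_subset hA.1 hA.2)))
    rwa [← this]

theorem union_mem (hG : IsSwmGraph G) (h : IsLevelCube G p z T ψ) (hu : u ∈ interval G p z)
    {A B : Finset ι} (hA : A ⊆ T) (hB : B ⊆ T) (hAu : ψ A ∈ interval G p u)
    (hBu : ψ B ∈ interval G p u) : ψ (A ∪ B) ∈ interval G p u := by
  have hc := hG.connected
  induction B using Finset.induction_on with
  | empty => simpa using hAu
  | insert i B hi ih =>
    have h1 := interval_trans hc (h.mono' hc (Finset.subset_insert i B) hB) hBu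
    have h2 : ψ {i} ∈ interval G p u := interval_trans hc (h.mono' hc (by simp) hB) hBu
    rw [Finset.insert_subset_iff] at hB
    rw [Finset.union_insert]
    exact h.insert_mem hG hu (Finset.union_subset hA hB.2) hB.1 (ih hB.2 h1) h2

end IsLevelCube

/-- In an interval, every walk can be pushed up to a walk through an upper bound of its ends. -/
theorem exists_upper_bound_of_walk (hG : IsSwmGraph G) {x y : interval G p z}
    (q : (G.induce (interval G p z)).Walk x y) :
    ∃ u ∈ interval G p z, (x : V) ∈ interval G p u ∧ (y : V) ∈ interval G p u ∧
      2 * G.dist p u ≤ q.length + G.dist p x + G.dist p y := by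
  have hc := hG.connected
  induction q with
  | @nil x => exact ⟨x, x.2, right_mem_interval _ _, right_mem_interval _ _, by simp; omega⟩
  | @cons x y t h q ih =>
    have hxy : G.Adj x y := h
    obtain ⟨u, hu, hyu, htu, hle⟩ := ih
    have h0 : G.dist p x ≠ G.dist p y := fun e => not_adj_of_dist_eq hG x.2 y.2 e hxy
    have h1 := dist_le_add_one hc hxy p
    have h2 := dist_le_add_one hc hxy.symm p
    rw [SimpleGraph.Walk.length_cons]
    by_cases hlt : G.dist p x < G.dist p y
    · have hcov : Cov G p x y := ⟨hxy, by omega⟩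
      exact ⟨u, hu, interval_trans hc hcov.mem_interval hyu, htu, by omega⟩
    · have hcov : Cov G p y x := ⟨hxy.symm, by omega⟩
      by_cases hxu : (x : V) ∈ interval G p u
      · exact ⟨u, hu, hxu, htu, by omega⟩
      -- Raising the bound by one costs two, paid by the extra edge and by `x` lying one level above
      -- `y`.
      · obtain ⟨v, h3, h4, h5⟩ := exists_cov_join hG hyu hcov hu x.2 hxu
        refine ⟨v, h4, h5, interval_trans hc htu h3.mem_interval, ?_⟩
        have := h3.2
        omega

theorem exists_isLevelCube (hG : IsSwmGraph G) (T : Finset ι) (h : AtomGenerated G p z)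
    (hT : T.card = G.dist p z) : ∃ ψ, IsLevelCube G p z T ψ := by
  have hc := hG.connected
  induction T using Finset.induction_on generalizing z with
  | empty =>
    have : p = z := hc.dist_eq_zero_iff.1 (by simpa using hT.symm)
    exact ⟨fun _ => p, rfl, this, by simp, by simp⟩
  | insert k T hk ih =>
    rw [Finset.card_insert_of_notMem hk] at hT
    have hpz : p ≠ z := by rintro rfl; simp at hT
    obtain ⟨w, hw⟩ := exists_lower_cov hc hpz
    obtain ⟨a, ha, haz, haw⟩ := h z (right_mem_interval _ _) w hw
    obtain ⟨ψ, hψ⟩ := ih (h.mono hc hw.mem_interval) (by have := hw.2; omega)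
    -- The new cube direction is the join with `a`: `θ u` is that join for `u ∈ I(p, w)`, and an
    -- irrelevant value elsewhere.
    have hex : ∀ u, ∃ y, u ∈ interval G p w →
        Cov G p u y ∧ y ∈ interval G p z ∧ a ∈ interval G p y := by
      intro u
      by_cases hu : u ∈ interval G p w
      · obtain ⟨y, hy⟩ := exists_cov_join hG (left_mem_interval p u) (cov_self ha)
          (interval_trans hc hu hw.mem_interval) haz (fun h => haw (interval_trans hc h hu))
        exact ⟨y, fun _ => hy⟩
      · exact ⟨u, fun h => absurd h hu⟩
    choose θ hθ using hex
    have hau : ∀ u ∈ interval G p w, a ∉ interval G p u := fun u hu h =>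
      haw (interval_trans hc h hu)
    have huniq : ∀ u ∈ interval G p w, ∀ y, Cov G p u y → y ∈ interval G p z →
        a ∈ interval G p y → y = θ u := by
      intro u hu y h1 h2 h3
      obtain ⟨h4, h5, h6⟩ := hθ u hu
      by_contra hne
      exact hau u hu (Cov.unique_below hG h1 h4 h2 h5 hne h3 h6)
    have hθcov : ∀ u v, Cov G p u v → v ∈ interval G p w → Cov G p (θ u) (θ v) := by
      intro u v huv hv
      have hu := interval_trans hc huv.mem_interval hv
      obtain ⟨h4, h5, h6⟩ := hθ u hu
      have hne : θ u ≠ v := fun h => hau v hv (h ▸ h6)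
      obtain ⟨j, h1, h2, h3⟩ := exists_join hG h4 huv hne h5
        (interval_trans hc hv hw.mem_interval)
      rwa [← huniq v hv j h2 h3 (interval_trans hc h6 h1.mem_interval)]
    have hmem : ∀ {A}, A ⊆ T → ψ A ∈ interval G p w := hψ.mem hc
    have hsub : ∀ {A}, A ⊆ insert k T → k ∉ A → A ⊆ T := fun h hk =>
      (Finset.subset_insert_iff_of_notMem hk).1 h
    have hsub' : ∀ {A}, A ⊆ insert k T → A.erase k ⊆ T := fun h =>
      Finset.subset_insert_iff.1 h
    refine ⟨fun A => if k ∈ A then θ (ψ (A.erase k)) else ψ A, ?_, ?_, ?_, ?_⟩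
    · simp [hψ.empty]
    · simp only [Finset.mem_insert_self, if_true, Finset.erase_insert hk, hψ.top]
      exact (huniq w (right_mem_interval _ _) z hw (right_mem_interval _ _) haz).symm
    · intro A hA i hi hiA
      by_cases hkA : k ∈ A
      · have hik : i ≠ k := by rintro rfl; exact hiA hkA
        have hiT : i ∈ T := (Finset.mem_insert.1 hi).resolve_left hik
        simp only [hkA, if_true, Finset.mem_insert, or_true]
        rw [Finset.erase_insert_of_ne hik]
        exact hθcov _ _ (hψ.cov _ (hsub' hA) i hiT (by simp [hiA]))
          (hmem (Finset.insert_subset hiT (hsub' hA)))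
      · have hAT := hsub hA hkA
        by_cases hik : i = k
        · subst hik
          simp only [hkA, if_false, Finset.mem_insert, true_or, if_true,
            Finset.erase_insert hkA]
          exact (hθ _ (hmem hAT)).1
        · have hiT : i ∈ T := (Finset.mem_insert.1 hi).resolve_left hik
          have hk' : k ∉ insert i A := by simp [hkA, Ne.symm hik]
          simp only [hkA, if_false, hk']
          exact hψ.cov A hAT i hiT hiA
    · have key : ∀ A ⊆ insert k T, ∀ j ∈ insert k T, k ≠ j → k ∉ A →
          θ (ψ A) ≠ ψ (insert j A) := by
        intro A hA j hj hkj hkA heq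
        have hjT : j ∈ T := (Finset.mem_insert.1 hj).resolve_left (Ne.symm hkj)
        have h6 := (hθ _ (hmem (hsub hA hkA))).2.2
        rw [heq] at h6
        exact hau _ (hmem (Finset.insert_subset hjT (hsub hA hkA))) h6
      intro A hA i hi j hj hij hiA hjA
      by_cases hik : i = k
      · subst hik
        have h1 : i ∉ insert j A := by simp [hij, hiA]
        simp only [Finset.mem_insert_self, if_true, Finset.erase_insert hiA, h1, if_false]
        exact key A hA j hj hij hiA
      by_cases hjk : j = k
      · subst hjk
        have h1 : j ∉ insert i A := by simp [Ne.symm hij, hjA]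
        simp only [Finset.mem_insert_self, if_true, Finset.erase_insert hjA, h1, if_false]
        exact (key A hA i hi (Ne.symm hij) hjA).symm
      have hiT : i ∈ T := (Finset.mem_insert.1 hi).resolve_left hik
      have hjT : j ∈ T := (Finset.mem_insert.1 hj).resolve_left hjk
      by_cases hkA : k ∈ A
      · simp only [hkA, if_true, Finset.mem_insert, or_true]
        rw [Finset.erase_insert_of_ne hik, Finset.erase_insert_of_ne hjk]
        have c1 := hψ.cov _ (hsub' hA) i hiT (by simp [hiA])
        have c2 := hψ.cov _ (hsub' hA) j hjT (by simp [hjA])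
        have hne := hψ.ne _ (hsub' hA) i hiT j hjT hij (by simp [hiA]) (by simp [hjA])
        have m1 := hmem (Finset.insert_subset hiT (hsub' hA))
        have m2 := hmem (Finset.insert_subset hjT (hsub' hA))
        obtain ⟨y, k1, k2, k3⟩ := exists_join hG c1 c2 hne m1 m2
        intro heq
        have t1 := hθ _ m1
        have t2 := hθ _ m2
        rw [← heq] at t2
        have := eq_of_common_covers hG hne k1 k2 t1.1 t2.1
          (interval_trans hc k3 hw.mem_interval) t1.2.1
        exact hau y k3 (this ▸ t1.2.2)
      · have h1 : k ∉ insert i A := by simp [hkA, Ne.symm hik]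
        have h2 : k ∉ insert j A := by simp [hkA, Ne.symm hjk]
        simp only [h1, h2, if_false]
        exact hψ.ne A (hsub hA hkA) i hiT j hjT hij hiA hjA

/-- A walk from `φ A` to `φ B` inside the interval gives an upper bound `u` of both, with `2 d(p,
u)` at most its length plus `|A| + |B|`. As `ψ (A ∪ B)` lies below `u`, the length is at least `2 |A
∪ B| - |A| - |B|`, the distance in the cube. -/
theorem AtomGenerated.isBooleanPair (hG : IsSwmGraph G) (h : AtomGenerated G p z) :
    IsBooleanPair G p z := by
  have hc := hG.connected
  obtain ⟨ψ, hψ⟩ := exists_isLevelCube hG (Finset.univ : Finset (Fin (G.dist p z))) h (by simp)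
  have hmem : ∀ A, ψ A ∈ interval G p z := fun A => hψ.mem hc (Finset.subset_univ A)
  have hcov : ∀ A i, i ∉ A → G.Adj (ψ A) (ψ (insert i A)) := fun A i hi =>
    (hψ.cov A (Finset.subset_univ A) i (Finset.mem_univ i) hi).1
  let φ : Finset (Fin (G.dist p z)) → interval G p z := fun A => ⟨ψ A, hmem A⟩
  have hhom : ∀ A B, (cube (G.dist p z)).Adj A B →
      (G.induce (interval G p z)).Adj (φ A) (φ B) := by
    intro A B hAB
    obtain ⟨i, hi⟩ := Finset.card_eq_one.1 hAB
    change G.Adj (ψ A) (ψ B)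
    by_cases hiA : i ∈ A
    · have hB : A = insert i B ∧ i ∉ B := by
        simp only [Finset.ext_iff, Finset.mem_symmDiff, Finset.mem_singleton,
          Finset.mem_insert] at hi ⊢
        grind
      rw [hB.1]
      exact (hcov B i hB.2).symm
    · have hB : B = insert i A := by
        simp only [Finset.ext_iff, Finset.mem_symmDiff, Finset.mem_singleton,
          Finset.mem_insert] at hi ⊢
        grind
      rw [hB]
      exact hcov A i hiA
  refine ⟨φ, fun A B => le_antisymm (dist_le_of_hom (cube_connected _) hhom A B) ?_⟩
  have hr : (G.induce (interval G p z)).Reachable (φ A) (φ B) := by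
    obtain ⟨q⟩ := (cube_connected _) A B
    exact (q.map (⟨φ, fun h => hhom _ _ h⟩ : cube _ →g _)).reachable
  obtain ⟨q, hq⟩ := hr.exists_walk_length_eq_dist
  obtain ⟨u, hu, hA, hB, hle⟩ := exists_upper_bound_of_walk hG q
  have h1 := hψ.union_mem hG hu (Finset.subset_univ A) (Finset.subset_univ B) hA hB
  rw [mem_interval, hψ.level (Finset.subset_univ _)] at h1
  have h2 : G.dist p (φ A) = A.card := hψ.level (Finset.subset_univ _)
  have h3 : G.dist p (φ B) = B.card := hψ.level (Finset.subset_univ _)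
  have h4 := card_symmDiff_add A B
  rw [cube_dist, ← hq]
  omega

/-- Parallel edges of a square go up or down together, since otherwise two vertices would have two
common covers. From a corner `S` of least level every edge therefore leads up, and since the
dimension is `d(p, z)`, the corner `S` must map to `p` and its opposite to `z`. -/
theorem exists_isLevelCube_of_squares [Fintype ι] (hG : IsSwmGraph G) {f : Finset ι → V}
    (hmem : ∀ A, f A ∈ interval G p z) (hadj : ∀ A i, G.Adj (f A) (f (symmDiff A {i})))
    (hne : ∀ A i j, i ≠ j → f A ≠ f (symmDiff (symmDiff A {i}) {j}))
    (hcard : Fintype.card ι = G.dist p z) : ∃ ψ, IsLevelCube G p z (Finset.univ : Finset ι) ψ := by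
  have hc := hG.connected
  have hT : ∀ (A : Finset ι) (i : ι), symmDiff (symmDiff A {i}) {i} = A := fun A i =>
    symmDiff_symmDiff_cancel_right {i} A
  have step : ∀ A i, G.dist p (f (symmDiff A {i})) = G.dist p (f A) + 1 ∨
      G.dist p (f A) = G.dist p (f (symmDiff A {i})) + 1 := by
    intro A i
    have h0 : G.dist p (f A) ≠ G.dist p (f (symmDiff A {i})) := fun e =>
      not_adj_of_dist_eq hG (hmem _) (hmem _) e (hadj A i)
    have h1 := dist_le_add_one hc (hadj A i) p
    have h2 := dist_le_add_one hc (hadj A i).symm p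
    omega
  have square : ∀ A i j, i ≠ j → Cov G p (f A) (f (symmDiff A {i})) →
      Cov G p (f (symmDiff A {j})) (f (symmDiff (symmDiff A {j}) {i})) := by
    intro A i j hij h
    refine ⟨hadj _ _, ?_⟩
    by_contra hcon
    have s1 := step A j
    have s2 := step (symmDiff A {j}) i
    have s3 := step (symmDiff A {i}) j
    have s4 := h.2
    have e : symmDiff (symmDiff A {i}) {j} = symmDiff (symmDiff A {j}) {i} :=
      symmDiff_right_comm _ _ _
    have a3 := hadj (symmDiff A {i}) j
    rw [e] at s3 a3
    have n1 := hne A j i hij.symm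
    have n2 := hne (symmDiff A {i}) i j hij
    rw [hT] at n2
    exact n2 (eq_of_common_covers hG n1 h ⟨a3.symm, by omega⟩ ⟨hadj _ _, by omega⟩
      ⟨(hadj _ _).symm, by omega⟩ (hmem _) (hmem _))
  obtain ⟨S, -, hS⟩ := Finset.exists_min_image (Finset.univ : Finset (Finset ι))
    (fun A => G.dist p (f A)) Finset.univ_nonempty
  have hS0 : symmDiff S ∅ = S := symmDiff_bot S
  have hcovS : ∀ i, Cov G p (f S) (f (symmDiff S {i})) := by
    intro i
    have h1 := hS (symmDiff S {i}) (Finset.mem_univ _)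
    have h2 := step S i
    exact ⟨hadj _ _, by omega⟩
  have hins : ∀ A i, i ∉ A → symmDiff S (insert i A) = symmDiff (symmDiff S A) {i} := by
    intro A i hi
    rw [insert_eq_symmDiff hi, symmDiff_assoc]
  have hcov : ∀ A i, i ∉ A → Cov G p (f (symmDiff S A)) (f (symmDiff S (insert i A))) := by
    intro A
    induction A using Finset.induction_on with
    | empty =>
      intro i _
      have := hcovS i
      rwa [hS0, insert_empty_eq]
    | insert j A hj ih =>
      intro i hi
      rw [Finset.mem_insert, not_or] at hi
      rw [hins _ i (by simp [hi]), hins A j hj]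
      refine square _ _ _ hi.1 ?_
      rw [← hins A i hi.2]
      exact ih i hi.2
  have hlev : ∀ A, G.dist p (f (symmDiff S A)) = G.dist p (f S) + A.card := by
    intro A
    induction A using Finset.induction_on with
    | empty => simp [hS0]
    | insert i A hi ih => rw [(hcov A i hi).2, ih, Finset.card_insert_of_notMem hi]; rfl
  have htop := hlev Finset.univ
  have htop' := hmem (symmDiff S Finset.univ)
  rw [mem_interval] at htop'
  rw [Finset.card_univ, hcard] at htop
  refine ⟨fun A => f (symmDiff S A), ?_, ?_, fun A _ i _ hi => hcov A i hi, ?_⟩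
  · have : p = f S := hc.dist_eq_zero_iff.1 (by omega)
    simp only [hS0, ← this]
  · exact hc.dist_eq_zero_iff.1 (by omega)
  · intro A _ i _ j _ hij hi hj
    simp only [hins _ _ hi, hins _ _ hj]
    have := hne (symmDiff (symmDiff S A) {i}) i j hij
    rwa [hT] at this

theorem IsBooleanPair.atomGenerated (hG : IsSwmGraph G) (h : IsBooleanPair G p z) :
    AtomGenerated G p z := by
  obtain ⟨φ, hφ⟩ := h
  have hφ' : ∀ A B, (G.induce (interval G p z)).dist (φ A) (φ B) = (symmDiff A B).card :=
    fun A B => (hφ A B).trans (cube_dist A B)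
  obtain ⟨ψ, hψ⟩ := exists_isLevelCube_of_squares (ι := Fin (G.dist p z)) hG
    (f := fun A => φ A) (fun A => (φ A).2)
    (fun A i => by
      have : (G.induce (interval G p z)).Adj (φ A) (φ (symmDiff A {i})) := by
        rw [← SimpleGraph.dist_eq_one_iff_adj, hφ']
        simp
      exact this)
    (fun A i j hij heq => by
      have h1 := hφ' A (symmDiff (symmDiff A {i}) {j})
      rw [← Subtype.ext heq, SimpleGraph.dist_self, symmDiff_assoc, symmDiff_symmDiff_cancel_left,
        eq_comm, Finset.card_eq_zero] at h1
      have : i ∈ symmDiff ({i} : Finset (Fin (G.dist p z))) {j} := by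
        simp [Finset.mem_symmDiff, hij]
      rw [h1] at this
      simp at this)
    (by simp)
  exact hψ.atomGenerated hG

/-- The cube description does not distinguish the two ends, whereas the one by atoms does. -/
theorem AtomGenerated.symm (hG : IsSwmGraph G) (h : AtomGenerated G p z) :
    AtomGenerated G z p :=
  (h.isBooleanPair hG).symm.atomGenerated hG

theorem AtomGenerated.mono_left (hG : IsSwmGraph G) (h : AtomGenerated G p z)
    (hx : x ∈ interval G p z) : AtomGenerated G x z := by
  rw [interval_comm] at hx
  exact ((h.symm hG).mono hG.connected hx).symm hG

theorem thickening_adj_iff (hG : IsSwmGraph G) :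
    (thickening G).Adj p z ↔ p ≠ z ∧ AtomGenerated G p z := by
  constructor
  · intro h
    refine ⟨h.ne, ?_⟩
    rcases h with h | h
    · exact AtomGenerated.of_adj hG h
    · exact h.2.atomGenerated hG
  · rintro ⟨hne, h⟩
    by_cases hadj : G.Adj p z
    · exact Or.inl hadj
    · exact Or.inr ⟨hG.connected.one_lt_dist_of_ne_of_not_adj hne hadj, h.isBooleanPair hG⟩

end Cube

/-! ### Gated sets: Helly property and local criterion -/

section Gated

variable {V : Type*} {G : SimpleGraph V} {p z a b c e m t u v w x y : V} {X A B C : Set V}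

theorem IsGated.exists_gate (h : IsGated G X) (x : V) : ∃ x' ∈ X, ∀ y ∈ X, x' ∈ interval G x y := by
  by_cases hx : x ∈ X
  · exact ⟨x, hx, fun y _ => left_mem_interval x y⟩
  · exact h x hx

theorem IsGated.interval_subset (hc : G.Connected) (h : IsGated G X) (hu : u ∈ X) (hv : v ∈ X) :
    interval G u v ⊆ X := by
  intro t ht
  obtain ⟨t', ht', hgate⟩ := h.exists_gate t
  have h1 := hgate u hu
  have h2 := hgate v hv
  have h3 := hc.dist_triangle (u := u) (v := t') (w := v)
  rw [mem_interval] at h1 h2 ht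
  rw [G.dist_comm (u := t') (v := u), G.dist_comm (u := t) (v := u)] at h1
  have : t = t' := hc.dist_eq_zero_iff.1 (by omega)
  rwa [this]

theorem isGated_univ : IsGated G Set.univ := fun _ hx => absurd (Set.mem_univ _) hx

theorem isGated_singleton (v : V) : IsGated G {v} :=
  fun x _ => ⟨v, rfl, fun y hy => by rw [hy]; exact right_mem_interval _ _⟩

theorem IsGated.inter (hc : G.Connected) (hA : IsGated G A) (hB : IsGated G B)
    (hAB : (A ∩ B).Nonempty) : IsGated G (A ∩ B) := by
  intro x _
  obtain ⟨y₀, hy₀⟩ := hAB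
  obtain ⟨g, hg, hgate⟩ := hA.exists_gate x
  obtain ⟨h, hh, hhate⟩ := hB.exists_gate g
  refine ⟨h, ⟨hA.interval_subset hc hg hy₀.1 (hhate y₀ hy₀.2), hh⟩, fun y hy => ?_⟩
  have h1 := hgate y hy.1
  have h2 := hhate y hy.2
  rw [interval_comm] at h1 h2 ⊢
  exact interval_trans hc h2 h1

/-- The gate in `C` of a point of `A ∩ B` lies between that point and points of `A ∩ C` and `B ∩ C`,
and gated sets are convex. -/
theorem IsGated.inter_inter_nonempty (hc : G.Connected) (hA : IsGated G A) (hB : IsGated G B)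
    (hC : IsGated G C) (hAB : (A ∩ B).Nonempty) (hAC : (A ∩ C).Nonempty)
    (hBC : (B ∩ C).Nonempty) : (A ∩ B ∩ C).Nonempty := by
  obtain ⟨x, hxA, hxB⟩ := hAB
  obtain ⟨y, hyA, hyC⟩ := hAC
  obtain ⟨z, hzB, hzC⟩ := hBC
  obtain ⟨g, hg, hgate⟩ := hC.exists_gate x
  exact ⟨g, ⟨hA.interval_subset hc hxA hyA (hgate y hyC),
    hB.interval_subset hc hxB hzB (hgate z hzC)⟩, hg⟩

/-- The members of the family are absorbed into `A` one by one; `A` stays gated and, by the case of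
three sets, keeps meeting the others. -/
theorem IsGated.inter_sInter (hc : G.Connected) {𝓕 : Set (Set V)} (hfin : 𝓕.Finite)
    (hgated : ∀ F ∈ 𝓕, IsGated G F) (hpair : ∀ F ∈ 𝓕, ∀ F' ∈ 𝓕, (F ∩ F').Nonempty)
    (hA : IsGated G A) (hne : A.Nonempty) (hmeet : ∀ F ∈ 𝓕, (A ∩ F).Nonempty) :
    (A ∩ ⋂₀ 𝓕).Nonempty ∧ IsGated G (A ∩ ⋂₀ 𝓕) := by
  induction 𝓕, hfin using Set.Finite.induction_on generalizing A with
  | empty => simpa using ⟨hne, hA⟩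
  | @insert B 𝓕 _ _ ih =>
    rw [Set.sInter_insert, ← Set.inter_assoc]
    simp only [Set.forall_mem_insert] at hgated hpair hmeet
    refine ih hgated.2 (fun F hF F' hF' => (hpair.2 F hF).2 F' hF') (hA.inter hc hgated.1 hmeet.1)
      hmeet.1 fun F hF => ?_
    exact hA.inter_inter_nonempty hc hgated.1 (hgated.2 F hF) hmeet.1 (hmeet.2 F hF)
      (hpair.1.2 F hF)

theorem induce_connected (hv : v ∈ X)
    (hstar : ∀ x ∈ X, x ≠ v → ∃ y ∈ X, G.Adj x y ∧ G.dist v y < G.dist v x) :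
    (G.induce X).Connected := by
  have hr : ∀ n, ∀ x : X, G.dist v x = n → (G.induce X).Reachable x ⟨v, hv⟩ := by
    intro n
    induction n using Nat.strong_induction_on with
    | _ n ih =>
      intro x hx
      by_cases hxv : (x : V) = v
      · have : x = ⟨v, hv⟩ := Subtype.ext hxv
        rw [this]
      · obtain ⟨y, hy, hadj, hlt⟩ := hstar x x.2 hxv
        have h1 : (G.induce X).Adj x ⟨y, hy⟩ := hadj
        exact h1.reachable.trans (ih _ (hx ▸ hlt) ⟨y, hy⟩ rfl)
  have : Nonempty X := ⟨⟨v, hv⟩⟩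
  exact ⟨fun x y => (hr _ x rfl).trans (hr _ y rfl).symm⟩

/-- In a weakly modular graph, a set of vertices inducing a connected subgraph and containing
the common neighbours of any two of its elements is gated. -/
theorem isGated_of_closed (hG : IsSwmGraph G) (hX : (G.induce X).Connected)
    (hcl : ∀ x ∈ X, ∀ y ∈ X, x ≠ y → ∀ z, G.Adj z x → G.Adj z y → z ∈ X) : IsGated G X := by
  have hc := hG.connected
  intro x _
  obtain ⟨v⟩ := hX.nonempty
  obtain ⟨x', -, hmin⟩ := (measure fun y : X => G.dist x y).wf.has_min Set.univ ⟨v, trivial⟩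
  replace hmin : ∀ y ∈ X, G.dist x x' ≤ G.dist x y := fun y hy =>
    not_lt.1 (hmin ⟨y, hy⟩ trivial)
  refine ⟨x', x'.2, ?_⟩
  -- Here `x'` is a point of `X` nearest to `x`; the induction runs over the distance from `x'`
  -- within `X`.
  have key : ∀ n, ∀ y : X, (G.induce X).dist x' y = n → G.dist x y = G.dist x x' + n := by
    intro n
    induction n using Nat.strong_induction_on with
    | _ n ih =>
    intro y hy
    cases n with
    | zero =>
      obtain rfl := hX.dist_eq_zero_iff.1 hy
      rfl
    | succ n =>
      have lower : ∀ y : X, (G.induce X).dist x' y = n + 1 → ∃ y' : X, G.Adj y' y ∧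
          (G.induce X).dist x' y' = n ∧ G.dist x y' = G.dist x x' + n := by
        intro y hy
        obtain ⟨y', hy'⟩ := exists_lower_cov hX (p := x') (z := y) (by rintro rfl; simp at hy)
        have h1 := hy'.2
        exact ⟨y', hy'.1, by omega, ih n (by omega) y' (by omega)⟩
      have hge : ∀ y : X, (G.induce X).dist x' y = n + 1 → G.dist x x' + n ≤ G.dist x y := by
        intro y hy
        obtain ⟨y', hadj, h1, h2⟩ := lower y hy
        by_contra hlt
        have h3 := hmin y y.2
        have h4 := dist_le_add_one hc hadj.symm x
        have hne : x' ≠ y' := by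
          rintro rfl
          rw [SimpleGraph.dist_self] at h1
          omega
        obtain ⟨y'', hy''⟩ := exists_lower_cov hX hne
        have h5 := hy''.2
        have h6 := ih ((G.induce X).dist x' y'') (by omega) y'' rfl
        have hadj'' : G.Adj y'' y' := hy''.1
        have hny : (y'' : V) ≠ y := fun h => by
          have : y'' = y := Subtype.ext h
          subst this
          omega
        have hna : ¬ G.Adj y'' y := fun h => by
          have h7 : (G.induce X).Adj y'' y := h
          have h8 := dist_le_add_one hX h7 x'
          omega
        -- The vertex `t` lies in `X` at induced distance `n` from `x'`, but is closer to `x` than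
        -- the induction hypothesis allows.
        obtain ⟨t, ht, ht'⟩ := exists_lower_of_common_upper (p := x) hG
          (u := y'') (v := y) (z := y') ⟨hadj'', by omega⟩ ⟨hadj.symm, by omega⟩ hny hna
        have htX := hcl _ y''.2 _ y.2 hny t ht.1 ht'.1
        have h7 : (G.induce X).Adj y'' ⟨t, htX⟩ := ht.1.symm
        have h8 : (G.induce X).Adj ⟨t, htX⟩ y := ht'.1
        have h9 := dist_le_add_one hX h7 x'
        have h10 := dist_le_add_one hX h8 x'
        have h11 := ih _ (by omega) ⟨t, htX⟩ rfl
        have h12 := ht.2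
        simp only at h11
        omega
      obtain ⟨y', hadj, h1, h2⟩ := lower y hy
      have h3 := hge y hy
      have h4 := dist_le_add_one hc hadj x
      by_contra hne
      -- The induced distance from `x'` to `t` is `n` or `n + 1`: `hge` excludes the latter, the
      -- induction hypothesis the former.
      obtain ⟨t, ht, ht'⟩ := exists_lower_of_adj (p := x) hG hadj (by omega)
      have htX := hcl _ y'.2 _ y.2 hadj.ne t ht.1 ht'.1
      have h5 : (G.induce X).Adj y' ⟨t, htX⟩ := ht.1.symm
      have h6 : (G.induce X).Adj ⟨t, htX⟩ y := ht'.1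
      have h7 := dist_le_add_one hX h5 x'
      have h8 := dist_le_add_one hX h6 x'
      have h9 := ht.2
      have h10 : (G.induce X).dist x' ⟨t, htX⟩ ≠ n + 1 := fun h => by
        have := hge ⟨t, htX⟩ h
        simp only at this
        omega
      have h11 := ih _ (by omega) ⟨t, htX⟩ rfl
      simp only at h11
      omega
  intro y hy
  have h1 := key _ ⟨y, hy⟩ rfl
  have h2 := dist_le_of_hom (H := G.induce X) (G := G) hX (φ := Subtype.val) (fun _ _ h => h) x'
    ⟨y, hy⟩
  have h3 := hc.dist_triangle (u := x) (v := x') (w := y)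
  rw [mem_interval]
  simp only at h1 h2
  omega

end Gated

/-! ### Balls of the thickening are gated -/

section Expansion

variable {V : Type*} {G : SimpleGraph V} {p z a b c e m t u v w x y : V} {X : Set V}

/-- The triangle `w, x, z` is carried down a ladder of squares joining the edge `wx` to the edge
`pa`. At each rung, the triangle condition from `z` produces the next apex, and at the bottom the
apex is `a'`. -/
theorem exists_parallel_atom (hG : IsSwmGraph G) (n : ℕ) (hpw : G.dist p w = n)
    (ha : G.Adj p a) (hwx : Cov G p w x) (hax : G.dist a x = n) (haw : G.dist a w = n + 1)
    (hzw : G.Adj z w) (hzx : G.Adj z x) (hpz : G.dist p z = n + 1) :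
    ∃ a', G.Adj p a' ∧ G.Adj a a' ∧ G.dist a' z ≤ n := by
  have hc := hG.connected
  induction n generalizing w x z with
  | zero =>
    obtain rfl := hc.dist_eq_zero_iff.1 hpw
    obtain rfl := hc.dist_eq_zero_iff.1 hax
    exact ⟨z, hzw.symm, hzx.symm, by simp⟩
  | succ n ih =>
    obtain ⟨w₁, hw₁⟩ := exists_lower_cov hc (p := p) (z := w) (by rintro rfl; simp at hpw)
    have e1 := hw₁.2
    have e2 := hwx.2
    have e3 := dist_le_add_one hc hw₁.1 a
    have e4 := hc.dist_triangle (u := a) (v := p) (w := w₁)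
    rw [SimpleGraph.dist_eq_one_iff_adj.2 ha.symm] at e4
    have hsep : ∀ {s t}, G.dist p s + 1 < G.dist p t → s ≠ t ∧ ¬ G.Adj s t := by
      intro s t hst
      refine ⟨by rintro rfl; omega, fun h => ?_⟩
      have := dist_le_add_one hc h p
      omega
    obtain ⟨hne, hna⟩ := hsep (s := w₁) (t := x) (by omega)
    obtain ⟨x₁, hx₁, hx₁'⟩ := exists_lower_of_common_upper (p := a) hG (u := w₁) (v := x) (z := w)
      ⟨hw₁.1, by omega⟩ ⟨hwx.1.symm, by omega⟩ hne hna
    have e5 := hx₁.2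
    have e6 := dist_le_add_one hc hx₁.1.symm p
    have e7 := dist_le_add_one hc hx₁'.1 p
    obtain ⟨hne', hna'⟩ := hsep (s := w₁) (t := z) (by omega)
    have hzx₁ : z ≠ x₁ := by rintro rfl; omega
    have hnzx₁ : ¬ G.Adj z x₁ := fun h => by
      have hx₁w : x₁ ≠ w := by rintro rfl; omega
      have := dist_le_add_one hc
        (adj_of_common_edge hG hzx h.symm hx₁'.1 hzw.symm hwx.1 hx₁w) a
      omega
    have d1 : G.dist z w₁ = 2 := by
      have h1 := hc.one_lt_dist_of_ne_of_not_adj hne'.symm (fun h => hna' h.symm)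
      have h2 := dist_le_add_one hc hw₁.1.symm z
      rw [SimpleGraph.dist_eq_one_iff_adj.2 hzw] at h2
      omega
    have d2 : G.dist z x₁ = 2 := by
      have h1 := hc.one_lt_dist_of_ne_of_not_adj hzx₁ hnzx₁
      have h2 := dist_le_add_one hc hx₁'.1.symm z
      rw [SimpleGraph.dist_eq_one_iff_adj.2 hzx] at h2
      omega
    obtain ⟨z₁, hz₁, hz₁'⟩ := exists_lower_of_adj (p := z) hG hx₁.1.symm (d1.trans d2.symm)
    have hzz₁ : G.Adj z z₁ := by
      rw [← SimpleGraph.dist_eq_one_iff_adj]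
      have := hz₁.2
      omega
    have e8 := dist_le_add_one hc hz₁.1.symm p
    have e9 := dist_le_add_one hc hzz₁.symm p
    obtain ⟨a', h1, h2, h3⟩ := ih (w := w₁) (x := x₁) (z := z₁) (by omega)
      ⟨hx₁.1.symm, by omega⟩ (by omega) (by omega) hz₁.1 hz₁'.1 (by omega)
    have h4 := dist_le_add_one hc hzz₁.symm a'
    exact ⟨a', h1, h2, by omega⟩

/-- For `w` below both `x` and `z`, an atom `a` of `x` outside `w` has a parallel atom `a'` below
`z`. It is not below `w`, as `I(p, x)` cannot contain the adjacent atoms `a` and `a'`. -/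
theorem AtomGenerated.of_adj_of_dist_eq (hG : IsSwmGraph G) (hx : AtomGenerated G p x)
    (h : G.Adj x z) (e : G.dist p x = G.dist p z) : AtomGenerated G p z := by
  have hc := hG.connected
  obtain ⟨w, hwx, hwz⟩ := exists_lower_of_adj hG h e
  obtain ⟨a, ha, hax, haw⟩ := hx x (right_mem_interval _ _) w hwx
  have h1 := dist_atom hG ha hax hwx.mem_interval haw
  have h2 := hwx.2
  have h3 := hwz.2
  have h4 := SimpleGraph.dist_eq_one_iff_adj.2 ha
  have h5 := hax
  rw [mem_interval] at h5
  obtain ⟨a', ha', haa', hle⟩ := exists_parallel_atom hG (G.dist p w) rfl ha hwx (by omega) h1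
    hwz.1.symm h.symm h3
  have h6 := SimpleGraph.dist_eq_one_iff_adj.2 ha'
  refine (hx.mono hc hwx.mem_interval).of_cov hG hwz ha' ?_ fun h7 => ?_
  · have := hc.dist_triangle (u := p) (v := a') (w := z)
    rw [mem_interval]
    omega
  · exact not_adj_of_dist_eq hG hax (interval_trans hc h7 hwx.mem_interval) (h4.trans h6.symm) haa'

/-- The vertices forming a Boolean pair with `p` are closed under common neighbours. -/
theorem AtomGenerated.of_common_neighbor (hG : IsSwmGraph G) (hx : AtomGenerated G p x)
    (hy : AtomGenerated G p y) (hxy : x ≠ y) (hzx : G.Adj z x) (hzy : G.Adj z y) :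
    AtomGenerated G p z := by
  have hc := hG.connected
  have key : ∀ s, AtomGenerated G p s → G.Adj z s → AtomGenerated G p z ∨ Cov G p s z := by
    intro s hs hzs
    have h1 := dist_le_add_one hc hzs p
    have h2 := dist_le_add_one hc hzs.symm p
    rcases Nat.lt_trichotomy (G.dist p s) (G.dist p z) with h | h | h
    · exact Or.inr ⟨hzs.symm, by omega⟩
    · exact Or.inl (hs.of_adj_of_dist_eq hG hzs.symm h)
    · have h3 : Cov G p z s := ⟨hzs, by omega⟩
      exact Or.inl (hs.mono hc h3.mem_interval)
  rcases key x hx hzx with h | h1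
  · exact h
  rcases key y hy hzy with h | h2
  · exact h
  -- Now `z` covers both `x` and `y`; an atom of `y` outside their meet is outside `x`.
  obtain ⟨c, -, hcy, hmax⟩ := exists_meet hG h1 h2 hxy
  obtain ⟨b, hb, hby, hbc⟩ := hy y (right_mem_interval _ _) c hcy
  exact hx.of_cov hG h1 hb (interval_trans hc hby h2.mem_interval) fun h => hbc (hmax b h hby)

/-- The set of all vertices forming a Boolean pair with an element of `X`. -/
def expansion (G : SimpleGraph V) (X : Set V) : Set V := {x | ∃ q ∈ X, AtomGenerated G q x}

theorem atomGenerated_gate (hG : IsSwmGraph G) (hx : x ∈ expansion G X)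
    (hgate : ∀ y ∈ X, w ∈ interval G x y) : AtomGenerated G w x := by
  obtain ⟨q, hq, hqx⟩ := hx
  have := hgate q hq
  rw [interval_comm] at this
  exact hqx.mono_left hG this

/-- Gates in `X` reduce closure under common neighbours to Boolean partners of one vertex: either
both neighbours of `z` are partners of the gate `z'` of `z`, or a neighbour with another gate
already shows that `z` is a partner of `z'`. -/
theorem isGated_expansion (hG : IsSwmGraph G) (hX : IsGated G X) (hv : v ∈ X) :
    IsGated G (expansion G X) := by
  have hc := hG.connected
  refine isGated_of_closed hG (induce_connected (v := v) ⟨v, hv, AtomGenerated.refl hc v⟩ ?_) ?_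
  · intro x hx hxv
    obtain ⟨x', hx', hgate⟩ := hX.exists_gate x
    have h1 := hgate v hv
    rw [interval_comm] at h1
    by_cases hxx : x' = x
    · subst hxx
      obtain ⟨y, hy⟩ := exists_lower_cov hc (Ne.symm hxv)
      refine ⟨y, ⟨y, hX.interval_subset hc hv hx' hy.mem_interval, AtomGenerated.refl hc y⟩,
        hy.1.symm, ?_⟩
      have := hy.2
      omega
    · obtain ⟨y, hy, hx'y⟩ := exists_lower_cov_of_mem hc h1 hxx
      have h2 := mem_interval_of_trans hc hx'y hy.mem_interval
      refine ⟨y, ⟨x', hx', (atomGenerated_gate hG hx hgate).mono hc h2⟩, hy.1.symm, ?_⟩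
      have := hy.2
      omega
  · intro x hx y hy hxy z hzx hzy
    obtain ⟨z', hz', hzgate⟩ := hX.exists_gate z
    have key : ∀ s ∈ expansion G X, G.Adj z s → z ∈ expansion G X ∨ AtomGenerated G z' s := by
      intro s hs hzs
      obtain ⟨s', hs', hsgate⟩ := hX.exists_gate s
      have hAG := atomGenerated_gate hG hs hsgate
      by_cases hsz : s' = z'
      · exact Or.inr (hsz ▸ hAG)
      · left
        have h1 := hsgate z' hz'
        have h2 := hzgate s' hs'
        have h3 := dist_le_add_one hc hzs s'
        have h4 := dist_le_add_one hc hzs.symm s'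
        have h5 := dist_le_add_one hc hzs z'
        have h6 := dist_le_add_one hc hzs.symm z'
        have h7 := hc.pos_dist_of_ne hsz
        rw [mem_interval] at h1 h2
        rw [G.dist_comm (u := s) (v := s'), G.dist_comm (u := s) (v := z')] at h1
        rw [G.dist_comm (u := z) (v := s'), G.dist_comm (u := z) (v := z'),
          G.dist_comm (u := z') (v := s')] at h2
        -- Distinct gates of adjacent vertices are adjacent. Seen from `s'`, the vertex `z` covers
        -- `s`, and `z'` is an atom below `z` but not below `s`.
        have h8 : G.Adj s' z' := SimpleGraph.dist_eq_one_iff_adj.1 (by omega)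
        have h9 : z' ∈ interval G s' z := by rw [mem_interval]; omega
        refine ⟨z', hz', (hAG.of_cov hG ⟨hzs.symm, by omega⟩ h8 h9 ?_).mono_left hG h9⟩
        rw [mem_interval]
        omega
    rcases key x hx hzx with h | h1
    · exact h
    rcases key y hy hzy with h | h2
    · exact h
    exact ⟨z', hz', h1.of_common_neighbor hG h2 hxy hzx hzy⟩

theorem thickening_connected (hG : IsSwmGraph G) : (thickening G).Connected :=
  hG.connected.mono fun _ _ h => Or.inl h

theorem mem_closedBall_self (G : SimpleGraph V) (v : V) (r : ℕ) : v ∈ closedBall G v r := by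
  simp [closedBall]

theorem closedBall_thickening_succ (hG : IsSwmGraph G) (v : V) (r : ℕ) :
    closedBall (thickening G) v (r + 1) = expansion G (closedBall (thickening G) v r) := by
  have hc := hG.connected
  have hc' := thickening_connected hG
  ext x
  constructor
  · intro hx
    change (thickening G).dist v x ≤ r + 1 at hx
    by_cases hle : (thickening G).dist v x ≤ r
    · exact ⟨x, hle, AtomGenerated.refl hc x⟩
    · obtain ⟨q, hq⟩ := exists_lower_cov hc' (p := v) (z := x) (by rintro rfl; simp at hle)
      refine ⟨q, ?_, ((thickening_adj_iff hG).1 hq.1).2⟩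
      have := hq.2
      change (thickening G).dist v q ≤ r
      omega
  · rintro ⟨q, hq, hqx⟩
    change (thickening G).dist v q ≤ r at hq
    change (thickening G).dist v x ≤ r + 1
    by_cases hne : q = x
    · subst hne
      omega
    · have := dist_le_add_one hc' ((thickening_adj_iff hG).2 ⟨hne, hqx⟩) v
      omega

/-- The balls of the thickening are gated in the original graph. -/
theorem isGated_closedBall_thickening (hG : IsSwmGraph G) (v : V) (r : ℕ) :
    IsGated G (closedBall (thickening G) v r) := by
  induction r with
  | zero =>
    have : closedBall (thickening G) v 0 = {v} := by
      ext x
      change (thickening G).dist v x ≤ 0 ↔ x = v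
      rw [Nat.le_zero, (thickening_connected hG).dist_eq_zero_iff, eq_comm]
    rw [this]
    exact isGated_singleton v
  | succ r ih =>
    rw [closedBall_thickening_succ hG]
    exact isGated_expansion hG ih (mem_closedBall_self _ v r)

theorem isFinitelyHellyGraph_thickening (hG : IsSwmGraph G) :
    IsFinitelyHellyGraph (thickening G) := by
  refine ⟨thickening_connected hG, fun 𝓕 h𝓕 hfin hpair => ?_⟩
  have hc := hG.connected
  obtain ⟨v⟩ := hc.nonempty
  have hgated : ∀ F ∈ 𝓕, IsGated G F := by
    intro F hF
    obtain ⟨v, r, rfl⟩ := h𝓕 hF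
    exact isGated_closedBall_thickening hG v r
  have := (IsGated.inter_sInter hc hfin hgated hpair isGated_univ ⟨v, trivial⟩
    fun F hF => by simpa using hpair F hF F hF).1
  simpa using this

end Expansion

/-! ### Cliques of the thickening and the infinite Helly property -/

section Cliques

variable {V : Type*} {G : SimpleGraph V} {p z a b c e m t u v w x y : V} {X : Set V}

/-- The set `X` is an intersection, possibly infinite, of gated sets of Boolean partners. Convexity
yields connectedness, and closure under common neighbours passes to intersections. -/
theorem isGated_of_mem_iff (hG : IsSwmGraph G) (hv : v ∈ X)
    (hX : ∀ x, x ∈ X ↔ ∀ y ∈ X, AtomGenerated G y x) : IsGated G X := by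
  have hc := hG.connected
  have hball : ∀ y, IsGated G {x | AtomGenerated G y x} := fun y => by
    have h : expansion G {y} = {x | AtomGenerated G y x} := by simp [expansion]
    exact h ▸ isGated_expansion hG (isGated_singleton y) rfl
  refine isGated_of_closed hG (induce_connected hv ?_) ?_
  · intro x hx hxv
    obtain ⟨y, hy⟩ := exists_lower_cov hc (Ne.symm hxv)
    refine ⟨y, (hX y).2 fun k hk => ?_, hy.1.symm, ?_⟩
    · exact (hball k).interval_subset hc ((hX v).1 hv k hk) ((hX x).1 hx k hk) hy.mem_interval
    · have := hy.2
      omega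
  · intro x hx y hy hxy z hzx hzy
    exact (hX z).2 fun k hk =>
      ((hX x).1 hx k hk).of_common_neighbor hG ((hX y).1 hy k hk) hxy hzx hzy

theorem isThick_of_atomGenerated (hG : IsSwmGraph G)
    (hX : ∀ x ∈ X, ∀ y ∈ X, AtomGenerated G x y) (hgated : IsGated G X) :
    IsThick (G.induce X) := by
  have hc := hG.connected
  intro u v huv
  have hr : (G.induce X).Reachable u v := SimpleGraph.Reachable.of_dist_ne_zero (by omega)
  obtain ⟨q, hq⟩ := hr.exists_walk_length_eq_dist
  have hle := SimpleGraph.dist_le (q.map (SimpleGraph.Embedding.induce X).toHom)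
  rw [SimpleGraph.Walk.length_map, hq, huv] at hle
  have hne : (u : V) ≠ v := fun h => by
    rw [Subtype.ext h, SimpleGraph.dist_self] at huv
    omega
  have hna : ¬ G.Adj u v := fun h => by
    have : (G.induce X).Adj u v := h
    rw [SimpleGraph.dist_eq_one_iff_adj.2 this] at huv
    omega
  have h2 : G.dist u v = 2 := le_antisymm hle (hc.one_lt_dist_of_ne_of_not_adj hne hna)
  obtain ⟨w, hw⟩ := exists_lower_cov hc hne
  obtain ⟨a, ha, hav, haw⟩ := hX u u.2 v v.2 v (right_mem_interval _ _) w hw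
  have huw : G.Adj u w := by
    rw [← SimpleGraph.dist_eq_one_iff_adj]
    have := hw.2
    omega
  have hav' : G.Adj a v := by
    rw [← SimpleGraph.dist_eq_one_iff_adj]
    rw [mem_interval, SimpleGraph.dist_eq_one_iff_adj.2 ha] at hav
    omega
  have hwX := hgated.interval_subset hc u.2 v.2 hw.mem_interval
  have haX := hgated.interval_subset hc u.2 v.2 hav
  have haw' : a ≠ w := by rintro rfl; exact haw (right_mem_interval _ _)
  have hnaw : ¬ G.Adj a w := not_adj_of_dist_eq hG hav hw.mem_interval
    ((SimpleGraph.dist_eq_one_iff_adj.2 ha).trans (SimpleGraph.dist_eq_one_iff_adj.2 huw).symm)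
  have hmem : ∀ s : X, G.Adj u s → G.Adj s v → s ∈ interval (G.induce X) u v := by
    intro s h3 h4
    have h5 : (G.induce X).Adj u s := h3
    have h6 : (G.induce X).Adj s v := h4
    rw [mem_interval, SimpleGraph.dist_eq_one_iff_adj.2 h5, SimpleGraph.dist_eq_one_iff_adj.2 h6,
      huv]
  exact ⟨u, left_mem_interval _ _, ⟨a, haX⟩, hmem _ ha hav', v, right_mem_interval _ _,
    ⟨w, hwX⟩, hmem _ huw hw.1, ha, hav', hw.1.symm, huw.symm, fun h => hne (congrArg _ h), hna,
    fun h => haw' (congrArg Subtype.val h), hnaw⟩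

/-- Every clique of the thickening is contained in a Boolean-gated set. -/
theorem exists_isBooleanGated_of_isClique (hG : IsSwmGraph G) {K : Set V}
    (hK : (thickening G).IsClique K) (hne : K.Nonempty) : ∃ X, K ⊆ X ∧ IsBooleanGated G X := by
  have hc := hG.connected
  obtain ⟨M, hKM, hM⟩ := zorn_subset_nonempty {s | (thickening G).IsClique s} (fun c hc hchain _ =>
    ⟨⋃₀ c, (Set.pairwise_sUnion hchain.directedOn).2 fun s hs => hc hs,
      fun s hs => Set.subset_sUnion_of_mem hs⟩) K hK
  have hMc : (thickening G).IsClique M := hM.prop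
  obtain ⟨v, hv⟩ := hne.mono hKM
  have hAG : ∀ x ∈ M, ∀ y ∈ M, AtomGenerated G x y := by
    intro x hx y hy
    by_cases hxy : x = y
    · exact hxy ▸ AtomGenerated.refl hc x
    · exact ((thickening_adj_iff hG).1 (hMc hx hy hxy)).2
  have hiff : ∀ x, x ∈ M ↔ ∀ y ∈ M, AtomGenerated G y x := by
    refine fun x => ⟨fun hx y hy => hAG y hy x hx, fun h => ?_⟩
    have hins : (thickening G).IsClique (insert x M) := by
      rw [SimpleGraph.isClique_insert]
      exact ⟨hMc, fun y hy hxy => ((thickening_adj_iff hG).2 ⟨hxy.symm, h y hy⟩).symm⟩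
    exact hM.le_of_ge hins (Set.subset_insert x M) (Set.mem_insert x M)
  have hgated := isGated_of_mem_iff hG hv hiff
  exact ⟨M, hKM, hgated, isThick_of_atomGenerated hG hAG hgated⟩

/-- If the Boolean-gated sets are finite, a ball of the thickening contains no infinite ascending
chain with respect to the order `x ≤ y ↔ x ∈ I(v, y)`. -/
theorem eventually_const_of_chain (hG : IsSwmGraph G)
    (hfin : ∀ X : Set V, IsBooleanGated G X → X.Finite) (v : V) (r : ℕ) (x : ℕ → V)
    (hx : ∀ i, x i ∈ closedBall (thickening G) v r)
    (hchain : ∀ i j, i ≤ j → x i ∈ interval G v (x j)) : ∃ N, ∀ i, N ≤ i → x i = x N := by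
  have hc := hG.connected
  induction r generalizing x with
  | zero =>
    have : ∀ i, v = x i := fun i =>
      (thickening_connected hG).dist_eq_zero_iff.1 (Nat.le_zero.1 (hx i))
    exact ⟨0, fun i _ => (this i).symm.trans (this 0)⟩
  | succ r ih =>
    have hgated := isGated_closedBall_thickening hG v r
    choose y hy hgate using fun i => hgated.exists_gate (x i)
    have hv := mem_closedBall_self (thickening G) v r
    have hyx : ∀ i, y i ∈ interval G v (x i) := fun i => by
      rw [interval_comm]
      exact hgate i v hv
    -- The gates in the smaller ball again form a chain, so the induction hypothesis makes them
    -- constant from some `N` on.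
    have hychain : ∀ i j, i ≤ j → y i ∈ interval G v (y j) := by
      intro i j hij
      have h1 := interval_trans hc (hyx i) (hchain i j hij)
      have h2 := hgate j (y i) (hy i)
      have h3 := hyx j
      rw [mem_interval] at h1 h2 h3 ⊢
      rw [G.dist_comm (u := x j), G.dist_comm (v := y i), G.dist_comm (u := x j)] at h2
      omega
    obtain ⟨N, hN⟩ := ih y hy hychain
    have hAG : ∀ i, N ≤ i → AtomGenerated G (y N) (x i) := by
      intro i hi
      rw [← hN i hi]
      refine atomGenerated_gate hG ?_ (hgate i)
      rw [← closedBall_thickening_succ hG]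
      exact hx i
    -- For `N ≤ i ≤ j`, the vertex `x i` lies between the common gate `y N` and its Boolean partner
    -- `x j`.
    have hclique : (thickening G).IsClique (x '' Set.Ici N) := by
      have key : ∀ i j, N ≤ i → i ≤ j → x i ≠ x j → (thickening G).Adj (x i) (x j) := by
        intro i j hi hij hne
        refine (thickening_adj_iff hG).2 ⟨hne, (hAG j (hi.trans hij)).mono_left hG ?_⟩
        have h1 := hyx i
        rw [hN i hi] at h1
        exact mem_interval_of_trans hc h1 (hchain i j hij)
      rintro _ ⟨i, hi, rfl⟩ _ ⟨j, hj, rfl⟩ hne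
      rcases le_total i j with h | h
      · exact key i j hi h hne
      · exact (key j i hj h hne.symm).symm
    obtain ⟨X, hKX, hX⟩ := exists_isBooleanGated_of_isClique hG hclique
      ⟨x N, N, Set.self_mem_Ici, rfl⟩
    have hfin' := (hfin X hX).subset hKX
    obtain ⟨_, ⟨M, hM, rfl⟩, hmax⟩ := hfin'.exists_maximalFor (G.dist v) _
      ⟨x N, N, Set.self_mem_Ici, rfl⟩
    refine ⟨M, fun i hi => ?_⟩
    have h1 := hchain M i hi
    have h2 := hmax ⟨i, le_trans hM hi, rfl⟩
    rw [mem_interval] at h1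
    exact (hc.dist_eq_zero_iff.1 (by
      have := h2 (by omega)
      omega)).symm

theorem isHellyGraph_thickening (hG : IsSwmGraph G)
    (hfin : ∀ X : Set V, IsBooleanGated G X → X.Finite) : IsHellyGraph (thickening G) := by
  refine ⟨thickening_connected hG, fun 𝓕 h𝓕 hpair => ?_⟩
  have hc := hG.connected
  obtain ⟨v₀⟩ := hc.nonempty
  rcases 𝓕.eq_empty_or_nonempty with rfl | ⟨B₀, hB₀⟩
  · exact ⟨v₀, by simp⟩
  have hgated : ∀ F ∈ 𝓕, IsGated G F := by
    intro F hF
    obtain ⟨v, r, rfl⟩ := h𝓕 hF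
    exact isGated_closedBall_thickening hG v r
  obtain ⟨v, r, hBv⟩ := h𝓕 hB₀
  have hsub : ∀ C : {C : Set (Set V) // C ⊆ 𝓕 ∧ C.Finite},
      (B₀ ∩ ⋂₀ C.1).Nonempty ∧ IsGated G (B₀ ∩ ⋂₀ C.1) := fun C =>
    IsGated.inter_sInter hc C.2.2 (fun F hF => hgated F (C.2.1 hF))
      (fun F hF F' hF' => hpair F (C.2.1 hF) F' (C.2.1 hF')) (hgated B₀ hB₀)
      (by simpa using hpair B₀ hB₀ B₀ hB₀) (fun F hF => hpair B₀ hB₀ F (C.2.1 hF))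
  choose g hg hgate using fun C => (hsub C).2.exists_gate v
  by_contra hempty
  have hstep : ∀ C : {C : Set (Set V) // C ⊆ 𝓕 ∧ C.Finite}, ∃ F ∈ 𝓕, g C ∉ F := by
    intro C
    by_contra! hcon
    exact hempty ⟨g C, hcon⟩
  choose F hF hgF using hstep
  -- Without a common point, some ball always misses the current gate. Adjoining it repeatedly gives
  -- a chain of gates in `B₀` that cannot become constant.
  let next : {C : Set (Set V) // C ⊆ 𝓕 ∧ C.Finite} → {C : Set (Set V) // C ⊆ 𝓕 ∧ C.Finite} :=
    fun C => ⟨insert (F C) C.1, Set.insert_subset (hF C) C.2.1, C.2.2.insert _⟩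
  let C : ℕ → {C : Set (Set V) // C ⊆ 𝓕 ∧ C.Finite} := fun n =>
    next^[n] ⟨∅, Set.empty_subset _, Set.finite_empty⟩
  have hC : ∀ n, C (n + 1) = next (C n) := fun n => Function.iterate_succ_apply' _ _ _
  have hCmono : Monotone fun n => (C n).1 := monotone_nat_of_le_succ fun n => by
    rw [hC]
    exact Set.subset_insert _ _
  obtain ⟨N, hN⟩ := eventually_const_of_chain hG hfin v r (fun n => g (C n))
    (fun n => hBv ▸ (hg (C n)).1) (fun i j hij => hgate _ _
      ⟨(hg (C j)).1, Set.sInter_subset_sInter (hCmono hij) (hg (C j)).2⟩)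
  have h1 := hN (N + 1) (Nat.le_succ N)
  have h2 := (hg (C (N + 1))).2 (F (C N)) (by rw [hC]; exact Set.mem_insert _ _)
  rw [h1] at h2
  exact hgF _ h2

end Cliques

/-! ### Boolean-gated sets in locally finite graphs -/

section LocallyFinite

variable {V : Type*} {G : SimpleGraph V} {p q z a b c e m t u v w x y : V} {X : Set V}

theorem IsBooleanGated.exists_common_neighbor (hG : IsSwmGraph G) (hX : IsBooleanGated G X)
    (hp : p ∈ X) (hy : y ∈ X) (hpw : G.Adj p w) (hwy : Cov G p w y) :
    ∃ x ∈ X, G.Adj p x ∧ Cov G p x y ∧ x ≠ w := by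
  have hc := hG.connected
  have hw := hX.1.interval_subset hc hp hy hwy.mem_interval
  have hpy : G.dist p y = 2 := by rw [hwy.2, SimpleGraph.dist_eq_one_iff_adj.2 hpw]
  have hne : p ≠ y := by rintro rfl; simp at hpy
  have hna : ¬ G.Adj p y := fun h => by
    rw [SimpleGraph.dist_eq_one_iff_adj.2 h] at hpy
    omega
  have h1 : (G.induce X).Adj ⟨p, hp⟩ ⟨w, hw⟩ := hpw
  have h2 : (G.induce X).Adj ⟨w, hw⟩ ⟨y, hy⟩ := hwy.1
  have hd : (G.induce X).dist ⟨p, hp⟩ ⟨y, hy⟩ = 2 :=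
    le_antisymm (SimpleGraph.dist_le (.cons h1 (.cons h2 .nil)))
      ((h1.reachable.trans h2.reachable).one_lt_dist_of_ne_of_not_adj
        (fun h => hne (congrArg Subtype.val h)) hna)
  obtain ⟨a, ha, b, hb, c, hc', d, hd', hab, hbc, hcd, hda, hac, -, hbd, -⟩ := hX.2 _ _ hd
  have key : ∀ s ∈ interval (G.induce X) ⟨p, hp⟩ ⟨y, hy⟩, (s : V) ≠ p → (s : V) ≠ y →
      (s : V) ≠ w → ∃ x ∈ X, G.Adj p x ∧ Cov G p x y ∧ x ≠ w := by
    intro s hs hsp hsy hsw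
    rw [mem_interval, hd] at hs
    -- Unreachable pairs also have distance `0`, so membership in the interval does not by itself
    -- rule them out.
    have r1 : (G.induce X).dist ⟨p, hp⟩ s ≠ 0 := fun h => by
      rw [SimpleGraph.dist_eq_zero_iff_eq_or_not_reachable] at h
      rcases h with h | h
      · exact hsp (congrArg Subtype.val h.symm)
      · have h3 : (G.induce X).dist s ⟨y, hy⟩ = 2 := by
          rw [SimpleGraph.dist_eq_zero_of_not_reachable h] at hs
          omega
        exact h ((h1.reachable.trans h2.reachable).trans
          (SimpleGraph.Reachable.of_dist_ne_zero (by omega : _ ≠ 0)).symm)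
    have r2 : (G.induce X).dist s ⟨y, hy⟩ ≠ 0 := fun h => by
      rw [SimpleGraph.dist_eq_zero_iff_eq_or_not_reachable] at h
      rcases h with h | h
      · exact hsy (congrArg Subtype.val h)
      · exact h ((SimpleGraph.Reachable.of_dist_ne_zero r1).symm.trans
          (h1.reachable.trans h2.reachable))
    have h3 : (G.induce X).Adj ⟨p, hp⟩ s := SimpleGraph.dist_eq_one_iff_adj.1 (by omega)
    have h4 : (G.induce X).Adj s ⟨y, hy⟩ := SimpleGraph.dist_eq_one_iff_adj.1 (by omega)
    have h5 : G.Adj p s := h3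
    exact ⟨s, s.2, h5, ⟨h4, by rw [hpy, SimpleGraph.dist_eq_one_iff_adj.2 h5]⟩, hsw⟩
  by_contra hcon
  have hall : ∀ s ∈ interval (G.induce X) ⟨p, hp⟩ ⟨y, hy⟩,
      (s : V) = p ∨ (s : V) = y ∨ (s : V) = w := by
    intro s hs
    by_contra! h
    exact hcon (key s hs h.1 h.2.1 h.2.2)
  have e1 : (a : V) ≠ b := fun h => hab.ne (Subtype.ext h)
  have e2 : (b : V) ≠ c := fun h => hbc.ne (Subtype.ext h)
  have e3 : (c : V) ≠ d := fun h => hcd.ne (Subtype.ext h)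
  have e4 : (d : V) ≠ a := fun h => hda.ne (Subtype.ext h)
  have e5 : (a : V) ≠ c := fun h => hac (Subtype.ext h)
  have e6 : (b : V) ≠ d := fun h => hbd (Subtype.ext h)
  have f1 := hall a ha
  have f2 := hall b hb
  have f3 := hall c hc'
  have f4 := hall d hd'
  grind

/-- Induction moves the base point one step up, to `w₁`. The atom `y` over `w₁` outside `w` has, by
thickness, another lower cover `x` adjacent to `p`; if `x` were below `w`, so would `y`, the join of
`x` and `w₁`. -/
theorem IsBooleanGated.atomGenerated (hG : IsSwmGraph G) (hX : IsBooleanGated G X)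
    (hp : p ∈ X) (hq : q ∈ X) : AtomGenerated G p q := by
  have hc := hG.connected
  intro z hz w hw
  have hzX := hX.1.interval_subset hc hp hq hz
  clear hz
  induction n : G.dist p w generalizing p with
  | zero =>
    obtain rfl := hc.dist_eq_zero_iff.1 n
    exact ⟨z, hw.1, right_mem_interval _ _, fun h => hw.ne (eq_of_mem_interval_self hc h).symm⟩
  | succ n ih =>
    obtain ⟨w₁, hw₁, hw₁w⟩ := exists_cov_of_ne hc (left_mem_interval p w)
      (by rintro rfl; simp at n)
    have hpw₁ : G.Adj p w₁ := hw₁.1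
    have h1 := interval_trans hc hw₁w hw.mem_interval
    have hw₁X := hX.1.interval_subset hc hp hzX h1
    have d1 := SimpleGraph.dist_eq_one_iff_adj.2 hpw₁
    have d2 := hw.2
    have d3 := h1
    have d4 := hw₁w
    rw [mem_interval] at d3 d4
    obtain ⟨y, hy, hyz, hyw⟩ := ih (p := w₁) hw₁X ⟨hw.1, by omega⟩ (by omega)
    have d5 := SimpleGraph.dist_eq_one_iff_adj.2 hy
    have d6 := hyz
    rw [mem_interval] at d6
    have d7 := hc.dist_triangle (u := p) (v := y) (w := z)
    have d8 := dist_le_add_one hc hy p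
    have hcov : Cov G p w₁ y := ⟨hy, by omega⟩
    have hyz' : y ∈ interval G p z := by rw [mem_interval]; omega
    obtain ⟨x, -, hpx, hxy, hxw₁⟩ := hX.exists_common_neighbor hG hp
      (hX.1.interval_subset hc hp hzX hyz') hpw₁ hcov
    refine ⟨x, hpx, interval_trans hc hxy.mem_interval hyz', fun hxw => hyw ?_⟩
    obtain ⟨j, k1, k2, k3⟩ := exists_join hG (cov_self hpx) (cov_self hpw₁) hxw₁ hxw hw₁w
    have : y = j := eq_of_common_covers hG hxw₁ hxy hcov k1 k2 hyz'
      (interval_trans hc k3 hw.mem_interval)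
    subst this
    exact mem_interval_of_trans hc hcov.mem_interval k3

/-- Each step of a maximal chain brings a new atom; this bounds distances by degrees. -/
theorem AtomGenerated.exists_atoms (hG : IsSwmGraph G) (h : AtomGenerated G p z) :
    ∃ S : Finset V, S.card = G.dist p z ∧ ∀ a ∈ S, G.Adj p a ∧ a ∈ interval G p z := by
  classical
  have hc := hG.connected
  induction n : G.dist p z generalizing z with
  | zero => exact ⟨∅, rfl, by simp⟩
  | succ n ih =>
    obtain ⟨w, hw⟩ := exists_lower_cov hc (p := p) (z := z) (by rintro rfl; simp at n)
    obtain ⟨S, hS, hSw⟩ := ih (h.mono hc hw.mem_interval) (by have := hw.2; omega)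
    obtain ⟨a, ha, haz, haw⟩ := h z (right_mem_interval _ _) w hw
    refine ⟨insert a S, ?_, ?_⟩
    · rw [Finset.card_insert_of_notMem (fun h => haw (hSw a h).2), hS]
    · intro b hb
      rcases Finset.mem_insert.1 hb with rfl | hb
      · exact ⟨ha, haz⟩
      · exact ⟨(hSw b hb).1, interval_trans hc (hSw b hb).2 hw.mem_interval⟩

theorem finite_closedBall (hc : G.Connected) (hfin : ∀ v, (G.neighborSet v).Finite) (v : V)
    (r : ℕ) : (closedBall G v r).Finite := by
  induction r with
  | zero =>
    refine (Set.finite_singleton v).subset fun x hx => ?_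
    exact (hc.dist_eq_zero_iff.1 (Nat.le_zero.1 hx)).symm
  | succ r ih =>
    refine (ih.union (ih.biUnion fun u _ => hfin u)).subset fun x hx => ?_
    change G.dist v x ≤ r + 1 at hx
    by_cases hle : G.dist v x ≤ r
    · exact Or.inl hle
    · obtain ⟨w, hw⟩ := exists_lower_cov hc (p := v) (z := x) (by rintro rfl; simp at hle)
      refine Or.inr (Set.mem_biUnion (x := w) ?_ hw.1)
      have := hw.2
      change G.dist v w ≤ r
      omega

theorem IsBooleanGated.finite (hG : IsSwmGraph G) (hfin : ∀ v, (G.neighborSet v).Finite)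
    (hX : IsBooleanGated G X) : X.Finite := by
  rcases X.eq_empty_or_nonempty with rfl | ⟨v, hv⟩
  · exact Set.finite_empty
  refine (finite_closedBall hG.connected hfin v (hfin v).toFinset.card).subset fun x hx => ?_
  obtain ⟨S, hS, hSv⟩ := (hX.atomGenerated hG hv hx).exists_atoms hG
  change G.dist v x ≤ _
  rw [← hS]
  exact Finset.card_le_card fun a ha => (Set.Finite.mem_toFinset _).2 (hSv a ha).1

end LocallyFinite

/-! ### Cut-off functions for infinitely many homotopies -/

section Ramp

/-- A ramp falling from `1` to `0` on the interval `[1 / (n + 2), 1 / (n + 1)]`. -/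
noncomputable def ramp (n : ℕ) (t : ℝ) : ℝ := max 0 (min 1 ((n + 2) - (n + 1) * (n + 2) * t))

theorem continuous_ramp (n : ℕ) : Continuous (ramp n) := by
  unfold ramp
  fun_prop

theorem ramp_nonneg (n : ℕ) (t : ℝ) : 0 ≤ ramp n t := le_max_left _ _

theorem ramp_le_one (n : ℕ) (t : ℝ) : ramp n t ≤ 1 := max_le zero_le_one (min_le_left _ _)

theorem ramp_zero (n : ℕ) : ramp n 0 = 1 := by
  have : (1 : ℝ) ≤ n + 2 := by linarith [n.cast_nonneg (α := ℝ)]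
  simp [ramp, this]

theorem ramp_one (n : ℕ) : ramp n 1 = 0 := by
  have : ((n : ℝ) + 2) - (n + 1) * (n + 2) * 1 ≤ 0 := by nlinarith [n.cast_nonneg (α := ℝ)]
  exact max_eq_left ((min_le_right _ _).trans this)

/-- Ramps of larger index fall earlier, and the falling phases do not overlap: a positive value at
`m` forces `t < 1 / (m + 1) ≤ 1 / (n + 2)`. -/
theorem ramp_eq_one_of_lt {n m : ℕ} (h : n < m) {t : ℝ} (ht : 0 < ramp m t) : ramp n t = 1 := by
  have h1 : (n : ℝ) + 1 ≤ m := by exact_mod_cast h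
  have h2 : (0 : ℝ) ≤ n := n.cast_nonneg
  have h3 : 0 < ((m : ℝ) + 2) - (m + 1) * (m + 2) * t := by
    by_contra hle
    rw [ramp, max_eq_left ((min_le_right _ _).trans (not_lt.1 hle))] at ht
    exact lt_irrefl _ ht
  have h4 : ((m : ℝ) + 1) * t < 1 := by
    by_contra hge
    nlinarith
  have h5 : ((n : ℝ) + 2) * t ≤ 1 := by
    rcases le_or_gt 0 t with h0 | h0
    · nlinarith
    · nlinarith
  have h6 : 1 ≤ ((n : ℝ) + 2) - (n + 1) * (n + 2) * t := by nlinarith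
  rw [ramp, min_eq_left h6, max_eq_right zero_le_one]

theorem exists_ramp_index (N : ℕ) (t : ℝ) :
    ∃ m ≤ N, (∀ n < m, ramp n t = 1) ∧ ∀ n, m < n → n < N → ramp n t = 0 := by
  classical
  have hex : ∃ n, N ≤ n ∨ ramp n t < 1 := ⟨N, Or.inl le_rfl⟩
  refine ⟨Nat.find hex, Nat.find_min' hex (Or.inl le_rfl), fun n hn => ?_, fun n hn hnN => ?_⟩
  · have := Nat.find_min hex hn
    rw [not_or, not_lt] at this
    exact le_antisymm (ramp_le_one n t) this.2
  · have h1 := (Nat.find_spec hex).resolve_left (by omega)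
    by_contra h0
    have := ramp_eq_one_of_lt hn (lt_of_le_of_ne (ramp_nonneg n t) (Ne.symm h0))
    exact h1.ne this

end Ramp

/-! ### Continuity for the weak topology -/

section Realization

variable {V : Type*} {K : AbstractSimplicialComplex V}

theorem Realization.ext {x y : Realization K} (h : x.coord = y.coord) : x = y := by
  cases x
  cases y
  congr

/-- The preimages of the finitely many closed simplices with vertices in `T` form a finite closed
cover of `Y`, on whose members the map factors through one simplex. -/
theorem continuous_of_continuous_coord {Y : Type*} [TopologicalSpace Y] {g : Y → Realization K}
    (T : Finset V) (hT : ∀ y, (g y).coord.support ⊆ T)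
    (hg : ∀ w, Continuous fun y => (g y).coord w) : Continuous g := by
  let Z : {s : K.faces // (s : Finset V) ⊆ T} → Set Y := fun s => {y | (g y).coord.support ⊆ s.1}
  have : Finite {s : K.faces // (s : Finset V) ⊆ T} := by
    refine Finite.of_injective (β := T.powerset)
      (fun s => ⟨s.1.1, Finset.mem_powerset.2 s.2⟩) fun s t h => ?_
    exact Subtype.ext (Subtype.ext (Subtype.mk.inj h))
  refine (locallyFinite_of_finite Z).continuous ?_ ?_ ?_
  · refine Set.eq_univ_of_forall fun y => Set.mem_iUnion.2 ?_
    exact ⟨⟨⟨(g y).coord.support, (g y).support_mem⟩, hT y⟩, Finset.Subset.refl _⟩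
  · intro s
    have : Z s = ⋂ w : {w // w ∉ (s.1 : Finset V)}, {y | (g y).coord w = 0} := by
      ext y
      simp only [Z, Set.mem_ofPred_eq, Set.mem_iInter, Subtype.forall, Finset.subset_iff,
        Finsupp.mem_support_iff]
      exact forall_congr' fun w => not_imp_comm
    rw [this]
    exact isClosed_iInter fun w => isClosed_eq (hg w) continuous_const
  · intro s
    rw [continuousOn_iff_continuous_domRestrict]
    let _ := closedSimplexTopology K s.1
    let g' : Z s → closedSimplex K s.1 := fun y => ⟨g y, y.2⟩
    have hg' : Continuous g' := continuous_induced_rng.2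
      (continuous_pi fun w => (hg w).comp continuous_subtype_val)
    have hval : Continuous (Subtype.val : closedSimplex K s.1 → Realization K) :=
      continuous_iSup_rng (i := s.1) continuous_coinduced_rng
    exact hval.comp hg'

/-- Continuity of a homotopy on the realization may be checked on the closed simplices. -/
theorem continuous_uncurry_of_closedSimplex {Y Z : Type*} [TopologicalSpace Y]
    [LocallyCompactSpace Y] [TopologicalSpace Z] (F : Realization K → Y → Z)
    (hF : ∀ s : K.faces, @Continuous _ _
      (@instTopologicalSpaceProd _ _ (closedSimplexTopology K (s : Finset V)) _) _
      fun q : closedSimplex K (s : Finset V) × Y => F q.1 q.2) :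
    Continuous (Function.uncurry F) := by
  have hx : ∀ x, Continuous (F x) := by
    intro x
    let s : K.faces := ⟨x.coord.support, x.support_mem⟩
    let _ := closedSimplexTopology K (s : Finset V)
    let x' : closedSimplex K (s : Finset V) := ⟨x, Finset.Subset.refl _⟩
    exact (hF s).comp (Continuous.prodMk_right x')
  -- Currying reduces the claim to a map out of the weak topology alone; local compactness of `Y`
  -- allows uncurrying.
  let Γ : Realization K → C(Y, Z) := fun x => ⟨F x, hx x⟩
  have hΓ : Continuous Γ := by
    refine continuous_iSup_dom.2 fun s => continuous_coinduced_dom.2 ?_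
    let _ := closedSimplexTopology K (s : Finset V)
    exact ContinuousMap.continuous_of_continuous_uncurry _ (hF s)
  exact ContinuousMap.continuous_uncurry_of_continuous ⟨Γ, hΓ⟩

end Realization

/-! ### Contraction through contiguous vertex maps -/

section Sweep

variable {V : Type*} {K : AbstractSimplicialComplex V}

/-- The point reached at time `t` when `x` is moved successively by the maps `ρ N, …, ρ 0`. -/
noncomputable def sweep (ρ : ℕ → V → V) (N : ℕ) (x : V →₀ ℝ) (t : ℝ) : V →₀ ℝ :=
  x.mapDomain (ρ 0) +
    ∑ n ∈ Finset.range N, ramp n t • (x.mapDomain (ρ (n + 1)) - x.mapDomain (ρ n))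

theorem mapDomain_eq_self {f : V → V} {x : V →₀ ℝ} (h : ∀ u ∈ x.support, f u = u) :
    x.mapDomain f = x :=
  (Finsupp.mapDomain_congr h).trans Finsupp.mapDomain_id

variable {ρ : ℕ → V → V} {N N' : ℕ} {x : V →₀ ℝ}

theorem sweep_of_le (hN : ∀ u ∈ x.support, ∀ n, N ≤ n → ρ n u = u) (h : N ≤ N') (t : ℝ) :
    sweep ρ N' x t = sweep ρ N x t := by
  have hn : ∀ n, N ≤ n → x.mapDomain (ρ n) = x := fun n hn =>
    mapDomain_eq_self fun u hu => hN u hu n hn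
  unfold sweep
  rw [← Finset.sum_subset (Finset.range_mono h)]
  intro n _ hnN
  rw [Finset.mem_range, not_lt] at hnN
  rw [hn n hnN, hn (n + 1) (by omega), sub_self, smul_zero]

/-- At most one ramp is strictly between `0` and `1`, so the sum telescopes to a segment between two
consecutive images of `x`, which contiguity keeps inside a simplex. -/
theorem exists_sweep_eq (hN : ∀ u ∈ x.support, ∀ n, N ≤ n → ρ n u = u) (t : ℝ) :
    ∃ m, ∃ s : ℝ, 0 ≤ s ∧ s ≤ 1 ∧
      sweep ρ N x t = (1 - s) • x.mapDomain (ρ m) + s • x.mapDomain (ρ (m + 1)) := by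
  obtain ⟨m, hmN, h1, h0⟩ := exists_ramp_index N t
  have hsum : ∑ n ∈ Finset.range m, ramp n t • (x.mapDomain (ρ (n + 1)) - x.mapDomain (ρ n)) =
      x.mapDomain (ρ m) - x.mapDomain (ρ 0) := by
    rw [← Finset.sum_range_sub fun n => x.mapDomain (ρ n)]
    exact Finset.sum_congr rfl fun n hn => by rw [h1 n (Finset.mem_range.1 hn), one_smul]
  rcases hmN.eq_or_lt with rfl | hlt
  · refine ⟨m, 0, le_rfl, zero_le_one, ?_⟩
    rw [sweep, hsum]
    simp
  · refine ⟨m, ramp m t, ramp_nonneg m t, ramp_le_one m t, ?_⟩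
    have hsub : Finset.range (m + 1) ⊆ Finset.range N := Finset.range_mono hlt
    rw [sweep, ← Finset.sum_subset hsub, Finset.sum_range_succ, hsum, smul_sub, sub_smul, one_smul]
    · abel
    · intro n hn hn'
      rw [Finset.mem_range] at hn hn'
      rw [h0 n (by omega) hn, zero_smul]

theorem sweep_zero (hN : ∀ u ∈ x.support, ∀ n, N ≤ n → ρ n u = u) : sweep ρ N x 0 = x := by
  simp only [sweep, ramp_zero, one_smul]
  rw [Finset.sum_range_sub (fun n => x.mapDomain (ρ n)), add_sub_cancel,
    mapDomain_eq_self fun u hu => hN u hu N le_rfl]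

theorem sweep_one (ρ : ℕ → V → V) (N : ℕ) (x : V →₀ ℝ) : sweep ρ N x 1 = x.mapDomain (ρ 0) := by
  simp [sweep, ramp_one]

theorem sum_support_eq (x : V →₀ ℝ) :
    ∑ v ∈ x.support, x v = Finsupp.linearCombination ℝ (fun _ : V => (1 : ℝ)) x := by
  simp [Finsupp.linearCombination_apply, Finsupp.sum]

theorem mapDomain_nonneg {f : V → V} (hx : ∀ v, 0 ≤ x v) (v : V) : 0 ≤ x.mapDomain f v := by
  classical
  rw [Finsupp.mapDomain, Finsupp.sum_apply]
  refine Finset.sum_nonneg fun u _ => ?_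
  simp only [Finsupp.single_apply]
  split_ifs
  exacts [hx u, le_rfl]

theorem mapDomain_apply_eq_sum [DecidableEq V] {f : V → V} {s : Finset V} (hs : x.support ⊆ s)
    (w : V) : x.mapDomain f w = ∑ u ∈ s, if f u = w then x u else 0 := by
  rw [Finsupp.mapDomain, Finsupp.sum_apply, Finsupp.sum_of_support_subset x hs]
  · exact Finset.sum_congr rfl fun u _ => by rw [Finsupp.single_apply]
  · intro u _
    simp

/-- The realization of a simplicial complex is contractible if there are maps `ρ n` of the vertex
set, the map `ρ 0` being constant, with `ρ n` and `ρ (n + 1)` contiguous, such that every vertex is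
fixed by almost all of them. -/
theorem contractibleSpace_of_contiguous (ρ : ℕ → V → V) (lev : V → ℕ) (v₀ : V)
    (hfix : ∀ u n, lev u ≤ n → ρ n u = u) (hconst : ∀ u, ρ 0 u = v₀)
    (hface : ∀ s ∈ K.faces, ∀ n, ∃ s' ∈ K.faces, ∀ u ∈ s, ρ n u ∈ s' ∧ ρ (n + 1) u ∈ s') :
    ContractibleSpace (Realization K) := by
  classical
  let N : Finset V → ℕ := fun s => s.sup lev
  have hN : ∀ {s : Finset V} {x : V →₀ ℝ}, x.support ⊆ s →
      ∀ u ∈ x.support, ∀ n, N s ≤ n → ρ n u = u := fun hs u hu n hn =>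
    hfix u n ((Finset.le_sup (f := lev) (hs hu)).trans hn)
  have hsupp : ∀ (x : V →₀ ℝ) n, ∀ v ∈ (x.mapDomain (ρ n)).support,
      ∃ u ∈ x.support, ρ n u = v := fun x n v hv =>
    Finset.mem_image.1 (Finsupp.mapDomain_support hv)
  have hex : ∀ (x : Realization K) (t : ℝ), ∃ y : Realization K,
      y.coord = sweep ρ (N x.coord.support) x.coord t := by
    intro x t
    obtain ⟨m, s, hs0, hs1, h⟩ := exists_sweep_eq (hN (Finset.Subset.refl x.coord.support)) t
    have hsum : ∑ v ∈ (sweep ρ (N x.coord.support) x.coord t).support,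
        sweep ρ (N x.coord.support) x.coord t v = 1 := by
      have h1 := x.sum_eq_one
      rw [sum_support_eq] at h1
      rw [sum_support_eq, h, map_add, map_smul, map_smul, Finsupp.linearCombination_mapDomain,
        Finsupp.linearCombination_mapDomain]
      simp only [Function.comp_def, h1, smul_eq_mul]
      ring
    refine ⟨⟨sweep ρ (N x.coord.support) x.coord t, ?_, fun v => ?_, hsum⟩, rfl⟩
    · obtain ⟨s', hs', hss'⟩ := hface _ x.support_mem m
      refine (K.isRelLowerSet_faces hs').2 ?_ ?_
      · intro v hv
        rw [h] at hv
        rcases Finset.mem_union.1 (Finsupp.support_add hv) with hv | hv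
        · obtain ⟨u, hu, rfl⟩ := hsupp _ _ v (Finsupp.support_smul hv)
          exact (hss' u hu).1
        · obtain ⟨u, hu, rfl⟩ := hsupp _ _ v (Finsupp.support_smul hv)
          exact (hss' u hu).2
      · by_contra hempty
        rw [Finset.not_nonempty_iff_eq_empty] at hempty
        rw [hempty] at hsum
        simp at hsum
    · rw [h]
      exact add_nonneg (mul_nonneg (sub_nonneg.2 hs1) (mapDomain_nonneg x.nonneg v))
        (mul_nonneg hs0 (mapDomain_nonneg x.nonneg v))
  choose F hF using hex
  have hcont : Continuous (Function.uncurry fun x (t : unitInterval) => F x t) := by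
    refine continuous_uncurry_of_closedSimplex _ fun s => ?_
    let _ := closedSimplexTopology K (s : Finset V)
    -- On one closed simplex a single number of terms serves all points, so the formula is uniform
    -- there.
    have hF' : ∀ q : closedSimplex K (s : Finset V) × unitInterval,
        (F q.1 q.2).coord = sweep ρ (N s) q.1.1.coord q.2 := fun q => by
      rw [hF, sweep_of_le (hN (Finset.Subset.refl _)) (Finset.sup_mono q.1.2)]
    have hcoord : ∀ u, Continuous fun x : closedSimplex K (s : Finset V) => x.1.coord u := fun u =>
      (continuous_apply u).comp continuous_induced_dom
    have hmap : ∀ n w, Continuous fun q : closedSimplex K (s : Finset V) × unitInterval =>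
        q.1.1.coord.mapDomain (ρ n) w := by
      intro n w
      have : (fun q : closedSimplex K (s : Finset V) × unitInterval =>
          q.1.1.coord.mapDomain (ρ n) w) =
          fun q => ∑ u ∈ (s : Finset V), if ρ n u = w then q.1.1.coord u else 0 :=
        funext fun q => mapDomain_apply_eq_sum q.1.2 w
      rw [this]
      refine continuous_finsetSum _ fun u _ => ?_
      split_ifs
      · exact (hcoord u).comp continuous_fst
      · exact continuous_const
    refine continuous_of_continuous_coord
      ((Finset.range (N s + 1)).biUnion fun n => (s : Finset V).image (ρ n)) (fun q => ?_)
      (fun w => ?_)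
    · have hmem : ∀ n ≤ N s, (q.1.1.coord.mapDomain (ρ n)).support ⊆
          (Finset.range (N s + 1)).biUnion fun n => (s : Finset V).image (ρ n) := by
        intro n hn v hv
        obtain ⟨u, hu, rfl⟩ := hsupp _ _ v hv
        exact Finset.mem_biUnion.2 ⟨n, Finset.mem_range.2 (by omega),
          Finset.mem_image_of_mem _ (q.1.2 hu)⟩
      rw [hF', sweep]
      refine Finsupp.support_add.trans (Finset.union_subset (hmem 0 (Nat.zero_le _)) ?_)
      refine Finsupp.support_finsetSum.trans (Finset.biUnion_subset.2 fun n hn => ?_)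
      rw [Finset.mem_range] at hn
      exact Finsupp.support_smul.trans (Finsupp.support_sub.trans
        (Finset.union_subset (hmem _ (by omega)) (hmem _ (by omega))))
    · simp only [hF', sweep, Finsupp.add_apply, Finsupp.finsetSum_apply, Finsupp.smul_apply,
        Finsupp.sub_apply, smul_eq_mul]
      refine (hmap 0 w).add (continuous_finsetSum _ fun n _ => ?_)
      exact ((continuous_ramp n).comp (continuous_subtype_val.comp continuous_snd)).mul
        ((hmap (n + 1) w).sub (hmap n w))
  have hv₀ : {v₀} ∈ K.faces := K.singleton_mem v₀
  let c : Realization K := ⟨Finsupp.single v₀ 1, by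
    rwa [Finsupp.support_single v₀ one_ne_zero], fun v => by
    rw [Finsupp.single_apply]
    split_ifs
    exacts [zero_le_one, le_rfl], by
    rw [Finsupp.support_single v₀ one_ne_zero]
    simp⟩
  rw [contractible_iff_id_nullhomotopic]
  refine ⟨c, ⟨⟨⟨fun q => F q.2 q.1, hcont.comp continuous_swap⟩, fun x => ?_, fun x => ?_⟩⟩⟩
  · refine Realization.ext ?_
    change (F x _).coord = x.coord
    rw [hF]
    exact sweep_zero (hN (Finset.Subset.refl _))
  · refine Realization.ext ?_
    change (F x _).coord = Finsupp.single v₀ 1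
    rw [hF]
    refine (sweep_one _ _ _).trans ?_
    have h1 := x.sum_eq_one
    rw [Finsupp.mapDomain_congr (g := fun _ => v₀) fun u _ => hconst u, Finsupp.mapDomain,
      Finsupp.sum, ← Finsupp.single_finsetSum, h1]

end Sweep

/-! ### Clique complexes of Helly graphs -/

section Helly

variable {V : Type*} {H : SimpleGraph V}

/-- In a Helly graph, every vertex `x ≠ v` is dominated in the ball around `v` having `x` on its
boundary by a vertex of a smaller ball. -/
theorem IsHellyGraph.exists_dominating (hH : IsHellyGraph H) {v x : V} (hx : x ≠ v) :
    ∃ y, H.dist v y < H.dist v x ∧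
      ∀ t, H.dist x t ≤ 1 → H.dist v t ≤ H.dist v x → H.dist y t ≤ 1 := by
  have hc := hH.1
  have hpos := hc.pos_dist_of_ne hx.symm
  -- The first ball forces `y` nearer to `v`, the unit balls force domination. The unit balls
  -- pairwise share `x`.
  let 𝓕 : Set (Set V) := insert (closedBall H v (H.dist v x - 1))
    {B | ∃ t, H.dist x t ≤ 1 ∧ H.dist v t ≤ H.dist v x ∧ B = closedBall H t 1}
  have hmix : ∀ t, H.dist v t ≤ H.dist v x →
      (closedBall H v (H.dist v x - 1) ∩ closedBall H t 1).Nonempty := by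
    intro t ht
    by_cases hlt : H.dist v t < H.dist v x
    · refine ⟨t, ?_, mem_closedBall_self H t 1⟩
      change H.dist v t ≤ H.dist v x - 1
      omega
    · obtain ⟨w, hw⟩ := exists_lower_cov hc (p := v) (z := t)
        (by rintro rfl; rw [SimpleGraph.dist_self] at hlt; omega)
      refine ⟨w, ?_, (SimpleGraph.dist_eq_one_iff_adj.2 hw.1.symm).le⟩
      have := hw.2
      change H.dist v w ≤ H.dist v x - 1
      omega
  obtain ⟨y, hy⟩ := hH.2 𝓕 (by
    rintro B (rfl | ⟨t, -, -, rfl⟩)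
    exacts [⟨_, _, rfl⟩, ⟨_, _, rfl⟩]) (by
    rintro B (rfl | ⟨t, ht, ht', rfl⟩) B' (rfl | ⟨t', hs, hs', rfl⟩)
    · exact ⟨v, mem_closedBall_self H v _, mem_closedBall_self H v _⟩
    · exact hmix t' hs'
    · rw [Set.inter_comm]
      exact hmix t ht'
    · refine ⟨x, ?_, ?_⟩
      · change H.dist t x ≤ 1
        rwa [H.dist_comm]
      · change H.dist t' x ≤ 1
        rwa [H.dist_comm])
  refine ⟨y, ?_, fun t ht ht' => ?_⟩
  · have : H.dist v y ≤ H.dist v x - 1 := hy _ (Or.inl rfl)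
    omega
  · have : H.dist t y ≤ 1 := hy _ (Or.inr ⟨t, ht, ht', rfl⟩)
    rwa [H.dist_comm]

/-- The composition `r n ∘ r (n + 1) ∘ ⋯ ∘ r (n + k - 1)`. -/
def compose (r : ℕ → V → V) : ℕ → ℕ → V → V
  | 0, _, u => u
  | k + 1, n, u => r n (compose r k (n + 1) u)

theorem IsHellyGraph.contractibleSpace (hH : IsHellyGraph H) :
    ContractibleSpace (Realization (cliqueComplex H)) := by
  classical
  have hc := hH.1
  obtain ⟨v⟩ := hc.nonempty
  have hex : ∀ x, ∃ y, x ≠ v → H.dist v y < H.dist v x ∧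
      ∀ t, H.dist x t ≤ 1 → H.dist v t ≤ H.dist v x → H.dist y t ≤ 1 := by
    intro x
    by_cases hx : x = v
    · exact ⟨x, fun h => absurd hx h⟩
    · obtain ⟨y, hy⟩ := hH.exists_dominating hx
      exact ⟨y, fun _ => hy⟩
  choose f hf using hex
  -- The fold of the sphere of radius `n + 1` into the ball of radius `n`.
  let r : ℕ → V → V := fun n u => if H.dist v u = n + 1 then f u else u
  have hne : ∀ {n u}, H.dist v u = n + 1 → u ≠ v := by
    rintro n u h rfl
    simp at h
  have hr1 : ∀ n u w, H.dist v u ≤ n + 1 → H.dist v w ≤ n + 1 → H.dist u w ≤ 1 →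
      H.dist (r n u) w ≤ 1 := by
    intro n u w hu hw huw
    simp only [r]
    split_ifs with h
    · exact (hf u (hne h)).2 w huw (by omega)
    · exact huw
  have hrlev : ∀ n u, H.dist v u ≤ n + 1 → H.dist v (r n u) ≤ n := by
    intro n u hu
    simp only [r]
    split_ifs with h
    · have := (hf u (hne h)).1
      omega
    · omega
  -- Folds of index at least `d(v, u)` fix `u`, so the infinite composition of all folds from `n` on
  -- is truncated there.
  let ρ : ℕ → V → V := fun n u => compose r (H.dist v u - n) n u
  have hfix : ∀ u n, H.dist v u ≤ n → ρ n u = u := by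
    intro u n h
    simp only [ρ, Nat.sub_eq_zero_of_le h, compose]
  have hstep : ∀ n u, ρ n u = r n (ρ (n + 1) u) := by
    intro n u
    by_cases h : H.dist v u ≤ n
    · rw [hfix u n h, hfix u (n + 1) (by omega)]
      simp only [r]
      rw [if_neg (by omega)]
    · obtain ⟨k, hk⟩ : ∃ k, H.dist v u - n = k + 1 := ⟨H.dist v u - n - 1, by omega⟩
      have hk' : H.dist v u - (n + 1) = k := by omega
      simp only [ρ, hk, hk', compose]
  have hlev : ∀ k n u, H.dist v u ≤ n + k → H.dist v (ρ n u) ≤ n := by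
    intro k
    induction k with
    | zero =>
      intro n u h
      rw [hfix u n h]
      exact h
    | succ k ih =>
      intro n u h
      rw [hstep]
      exact hrlev n _ (ih (n + 1) u (by omega))
  have hlev' : ∀ n u, H.dist v (ρ n u) ≤ n := fun n u => hlev (H.dist v u) n u (by omega)
  have hadj : ∀ k n u w, H.dist v u ≤ n + k → H.dist v w ≤ n + k → H.dist u w ≤ 1 →
      H.dist (ρ n u) (ρ n w) ≤ 1 := by
    intro k
    induction k with
    | zero =>
      intro n u w hu hw h
      rwa [hfix u n hu, hfix w n hw]
    | succ k ih =>
      intro n u w hu hw h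
      have h1 := ih (n + 1) u w (by omega) (by omega) h
      rw [hstep n u, hstep n w, H.dist_comm]
      refine hr1 n _ _ (hlev' _ _) ((hrlev n _ (hlev' _ _)).trans (by omega)) ?_
      rw [H.dist_comm]
      exact hr1 n _ _ (hlev' _ _) (hlev' _ _) h1
  have hadj' : ∀ n u w, H.dist u w ≤ 1 → H.dist (ρ n u) (ρ n w) ≤ 1 := fun n u w =>
    hadj (H.dist v u + H.dist v w) n u w (by omega) (by omega)
  -- Contiguity: one more fold replaces a vertex by one dominating it, so adjacency to the unfolded
  -- image survives.
  have hadj'' : ∀ n u w, H.dist u w ≤ 1 → H.dist (ρ n u) (ρ (n + 1) w) ≤ 1 := by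
    intro n u w h
    rw [hstep n u]
    exact hr1 n _ _ (hlev' _ _) (hlev' _ _) (hadj' _ _ _ h)
  have hclose : ∀ {x y}, H.dist x y ≤ 1 → x ≠ y → H.Adj x y := fun h hxy => by
    rw [← SimpleGraph.dist_eq_one_iff_adj]
    have := hc.pos_dist_of_ne hxy
    omega
  refine contractibleSpace_of_contiguous ρ (H.dist v) v hfix
    (fun u => (hc.dist_eq_zero_iff.1 (Nat.le_zero.1 (hlev' 0 u))).symm) fun s hs n => ?_
  refine ⟨s.image (ρ n) ∪ s.image (ρ (n + 1)), ⟨?_, ?_⟩, fun u hu =>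
    ⟨Finset.mem_union_left _ (Finset.mem_image_of_mem _ hu),
      Finset.mem_union_right _ (Finset.mem_image_of_mem _ hu)⟩⟩
  · exact (hs.1.image _).mono Finset.subset_union_left
  · have hs' : ∀ u ∈ s, ∀ w ∈ s, H.dist u w ≤ 1 := by
      intro u hu w hw
      by_cases huw : u = w
      · simp [huw]
      · exact (SimpleGraph.dist_eq_one_iff_adj.2 (hs.2 hu hw huw)).le
    intro x hx y hy hxy
    simp only [Finset.coe_union, Finset.coe_image, Set.mem_union, Set.mem_image,
      Finset.mem_coe] at hx hy
    rcases hx with ⟨u, hu, rfl⟩ | ⟨u, hu, rfl⟩ <;> rcases hy with ⟨w, hw, rfl⟩ | ⟨w, hw, rfl⟩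
    · exact hclose (hadj' _ _ _ (hs' u hu w hw)) hxy
    · exact hclose (hadj'' _ _ _ (hs' u hu w hw)) hxy
    · exact (hclose (hadj'' _ _ _ (hs' w hw u hu)) hxy.symm).symm
    · exact hclose (hadj' _ _ _ (hs' u hu w hw)) hxy

end Helly

end SwmGraph

theorem mainTheorem7 {V : Type*} (G : SimpleGraph V) (hG : SwmGraph.IsSwmGraph G) :
    SwmGraph.IsFinitelyHellyGraph (SwmGraph.thickening G) ∧
    ((∀ X : Set V, SwmGraph.IsBooleanGated G X → X.Finite) →
      SwmGraph.IsHellyGraph (SwmGraph.thickening G) ∧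
      ContractibleSpace
        (SwmGraph.Realization (SwmGraph.cliqueComplex (SwmGraph.thickening G)))) ∧
    ((∀ v : V, (G.neighborSet v).Finite) →
      ∀ X : Set V, SwmGraph.IsBooleanGated G X → X.Finite) := by
  have hHelly := SwmGraph.isHellyGraph_thickening hG
  exact ⟨SwmGraph.isFinitelyHellyGraph_thickening hG,
    fun hfin => ⟨hHelly hfin, (hHelly hfin).contractibleSpace⟩,
    fun hfin _ hX => hX.finite hG hfin⟩
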